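/- **Theorem 1.1 (Second order infinite-dimensional Poincaré inequality).** Let $\mathfrak H$ be a real separable Hilbert space and let $X=\{X(h):h\in\mathfrak H\}$ be an isonormal Gaussian process over $\mathfrak H$ on a probability space $(\Omega,\mathcal F,P)$, that is, a centered Gaussian family with $E[X(h)X(g)]=\langle h,g\rangle_{\mathfrak H}$ for all $h,g\in\mathfrak H$. For a cylindrical random variable $G=g(X(\phi_1),\dots,X(\phi_n))$, with $g:\mathbb R^n\to\mathbb R$ infinitely differentiable with compact support and $\phi_1,\dots,\phi_n\in\mathfrak H$, put $$DG=\sum_{i}\partial_i g(X(\phi_1),\dots,X(\phi_n))\,\phi_i,\qquad D^2G=\sum_{i,j}\partial_i\partial_j g(X(\phi_1),\dots,X(\phi_n))\,\phi_i\otimes\phi_j ,$$ random elements of $\mathfrak H$ and of the Hilbert tensor product $\mathfrak H\otimes\mathfrak H$. Let $\mathbb D^{2,4}$ be the closure of the set of cylindrical random variables with respect to the norm $\|G\|_{2,4}$ given by $\|G\|_{2,4}^4=E|G|^4+E\|DG\|_{\mathfrak H}^4+E\|D^2G\|_{\mathfrak H\otimes\mathfrak H}^4$, and for $F\in\mathbb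 D^{2,4}$ let $DF$, $D^2F$ denote the (first and second) Malliavin derivatives of $F$, obtained as the corresponding $L^4$-limits. Let $\|D^2F\|_{op}$ be the operator norm of the random Hilbert–Schmidt operator $\mathfrak H\to\mathfrak H$, $f\mapsto\langle f,D^2F\rangle_{\mathfrak H}$, where $\langle f,a\otimes b\rangle_{\mathfrak H}=\langle f,a\rangle_{\mathfrak H}\,b$. Let $F\in\mathbb D^{2,4}$ with $E(F)=\mu$ and $\mathrm{Var}(F)=\sigma^2$, where $\sigma>0$, and let $Z\sim\mathcal N(\mu,\sigma^2)$. Then $$d_W(F,Z)\le\frac{\sqrt{10}}{2\sigma}\,E\big[\|D^2F\|_{op}^4\big]^{1/4}\,E\big[\|DF\|_{\mathfrak H}^4\big]^{1/4},$$ where $d_W(F,Z)=\sup\{|E[f(F)]-E[f(Z)]| : f:\mathbb R\to\mathbb R,\ |f(x)-f(y)|\le|x-y| \text{ for all } x,y\}$. If, in addition, the law of $F$ is absolutely continuous with respect to the Lebesgue measure, then $$d_{TV}(F,Z)\le\frac{\sqrt{10}}{\sigma^2}\,E\big[\|D^2F\|_{op}^4\big]^{1/4}\,E\big[\|DF\|_{\mathfrak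 H}^4\big]^{1/4},$$ where $d_{TV}(F,Z)=\sup_A|P(F\in A)-P(Z\in A)|$, the supremum being over all Borel sets $A\subseteq\mathbb R$. -/

import Mathlib

open MeasureTheory ProbabilityTheory Filter Topology
open scoped ENNReal NNReal TensorProduct InnerProductSpace

noncomputable section

namespace Malliavin

/-- `X = {X(h) : h ∈ H}` is an isonormal Gaussian process over the real Hilbert space `H`: a centred
Gaussian family with covariance `E[X(h) X(g)] = ⟨h, g⟩`. -/
structure IsIsonormal {H Ω : Type*} [NormedAddCommGroup H] [InnerProductSpace ℝ H]
    [MeasurableSpace Ω] (X : H → Ω → ℝ) (P : Measure Ω) : Prop where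
  gaussian : IsGaussianProcess X P
  centered : ∀ h : H, ∫ ω, X h ω ∂P = 0
  covariance : ∀ h g : H, ∫ ω, X h ω * X g ω ∂P = ⟪h, g⟫_ℝ

/-- The Hilbert tensor product `H ⊗ H`: the completion of the algebraic tensor product for the
inner product with `⟨a ⊗ b, c ⊗ d⟩ = ⟨a, c⟩ ⟨b, d⟩`. -/
abbrev HTensor (H : Type*) [NormedAddCommGroup H] [InnerProductSpace ℝ H] : Type _ :=
  UniformSpace.Completion (H ⊗[ℝ] H)

/-- The elementary tensor `a ⊗ b` in the Hilbert tensor product. -/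
def tmulH {H : Type*} [NormedAddCommGroup H] [InnerProductSpace ℝ H] (a b : H) : HTensor H :=
  ((a ⊗ₜ[ℝ] b : H ⊗[ℝ] H) : UniformSpace.Completion (H ⊗[ℝ] H))

/-- The Hilbert-Schmidt operator `f ↦ ⟨f, T⟩_H` on `H` associated with `T ∈ H ⊗ H`, that is,
the operator `A` with `⟨A f, g⟩ = ⟨T, f ⊗ g⟩` for all `f, g ∈ H` (Riesz representation). It sends
`a ⊗ b` to `f ↦ ⟨f, a⟩ b`. -/
def contractOp {H : Type*} [NormedAddCommGroup H] [InnerProductSpace ℝ H] [CompleteSpace H]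
    (T : HTensor H) : H →L[ℝ] H :=
  InnerProductSpace.continuousLinearMapOfBilin (𝕜 := ℝ)
    ((ContinuousLinearMap.compL ℝ H (H ⊗[ℝ] H) ℝ
      ((innerSL ℝ T).comp UniformSpace.Completion.toComplL)).comp (TensorProduct.mkL ℝ H H))

/-- The partial derivative `∂g/∂xᵢ` of a function of `n` real variables. -/
def partialDeriv {n : ℕ} (i : Fin n) (g : (Fin n → ℝ) → ℝ) (x : Fin n → ℝ) : ℝ :=
  fderiv ℝ g x (Pi.single i 1)

/-- The data of a cylindrical random variable `g(X(φ₁), …, X(φₙ))`, with `g` smooth and compactly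
supported. (For `n = 0` it is a constant, which is also obtained with `n = 1` and `φ₁ = 0`.) -/
structure Cylinder (H : Type*) where
  n : ℕ
  g : (Fin n → ℝ) → ℝ
  φ : Fin n → H
  smooth : ContDiff ℝ ((⊤ : ℕ∞) : WithTop ℕ∞) g
  compact : HasCompactSupport g

namespace Cylinder

variable {H Ω : Type*} [NormedAddCommGroup H] [InnerProductSpace ℝ H]

/-- The random vector `(X(φ₁), …, X(φₙ))`. -/
def vec (G : Cylinder H) (X : H → Ω → ℝ) (ω : Ω) : Fin G.n → ℝ := fun i ↦ X (G.φ i) ω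

/-- The random variable `g(X(φ₁), …, X(φₙ))`. -/
def val (G : Cylinder H) (X : H → Ω → ℝ) (ω : Ω) : ℝ := G.g (G.vec X ω)

/-- Its Malliavin derivative `∑ᵢ ∂ᵢg(X(φ₁), …, X(φₙ)) φᵢ`. -/
def D (G : Cylinder H) (X : H → Ω → ℝ) (ω : Ω) : H :=
  ∑ i, partialDeriv i G.g (G.vec X ω) • G.φ i

/-- Its second Malliavin derivative `∑ᵢⱼ ∂ᵢ∂ⱼg(X(φ₁), …, X(φₙ)) φᵢ ⊗ φⱼ`. -/
def D2 (G : Cylinder H) (X : H → Ω → ℝ) (ω : Ω) : HTensor H :=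
  ∑ i, ∑ j, partialDeriv i (partialDeriv j G.g) (G.vec X ω) • tmulH (G.φ i) (G.φ j)

end Cylinder

/-- For `1 ≤ p < ∞`: `F` belongs to `𝔻^{2,p}`, with first and second Malliavin derivatives `DF` and `D2F` (as
`L^p`-random elements of `H` and `H ⊗ H`, determined up to null sets): there are cylindrical random
variables `Gₖ` with `Gₖ → F`, `D Gₖ → DF` and `D² Gₖ → D2F` in `L^p`. In other words, `F` is in the
closure of the cylindrical random variables for
`‖F‖_{2,p}^p = E|F|^p + E‖DF‖^p + E‖D²F‖^p`, and `DF`, `D2F` are the limits of the derivatives. -/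
structure IsMalliavin2 {H Ω : Type*} [NormedAddCommGroup H] [InnerProductSpace ℝ H]
    [MeasurableSpace Ω] (X : H → Ω → ℝ) (P : Measure Ω) (p : ℝ≥0∞)
    (F : Ω → ℝ) (DF : Ω → H) (D2F : Ω → HTensor H) : Prop where
  memLp : MemLp F p P
  memLp_D : MemLp DF p P
  memLp_D2 : MemLp D2F p P
  exists_seq : ∃ G : ℕ → Cylinder H,
    Tendsto (fun k ↦ eLpNorm (fun ω ↦ (G k).val X ω - F ω) p P) atTop (𝓝 0) ∧
    Tendsto (fun k ↦ eLpNorm (fun ω ↦ (G k).D X ω - DF ω) p P) atTop (𝓝 0) ∧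
    Tendsto (fun k ↦ eLpNorm (fun ω ↦ (G k).D2 X ω - D2F ω) p P) atTop (𝓝 0)

/-- The Wasserstein distance `sup_{‖f‖_Lip ≤ 1} |∫ f dμ - ∫ f dν|` between two laws on `ℝ` with
finite first moment. -/
def wassersteinDist (μ ν : Measure ℝ) : ℝ≥0∞ :=
  ⨆ (f : ℝ → ℝ) (_ : LipschitzWith 1 f), ENNReal.ofReal |∫ x, f x ∂μ - ∫ x, f x ∂ν|

/-- The total variation distance `sup_A |μ(A) - ν(A)|` (`A` Borel) between two probability laws
on `ℝ`. -/
def tvDist (μ ν : Measure ℝ) : ℝ≥0∞ :=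
  ⨆ (A : Set ℝ) (_ : MeasurableSet A), ENNReal.ofReal |μ.real A - ν.real A|

end Malliavin

end

namespace Malliavin

/-! The law of F is close to N(μ, σ²) when Stein's identity E[h(F)(F − μ)] = σ² E[h'(F)] almost
holds. The proof bounds its error by κ sup|h'| with κ = (3/2) ‖D²F‖ ‖DF‖, where both norms are in L⁴
and the first is built on the operator norm. An error κ costs κ/σ in Wasserstein distance and 2κ/σ²
in total variation, and 3 ≤ √10.

To find κ, let F = f(x) with f smooth on a Euclidean space and x standard Gaussian. For y an
independent copy of x, differentiate E[u(x) f(cos θ x + sin θ y)] in θ and integrate by parts: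
Cov(u, f) is the integral over [0, π/2] of sin θ E⟨∇u(x), ∇f(cos θ x + sin θ y)⟩
(`integral_mul_sub_eq_integral_inner`). Taking u = h∘f and u = f turns the Stein error into the
integral of sin θ Cov(h'(f), S_θ), where S_θ(x) is the mean over y of ⟨∇f(x), ∇f(cos θ x + sin θ
y)⟩. This covariance is at most sup|h'| times the standard deviation of S_θ. By the Poincaré
inequality, itself a consequence of the covariance formula, that deviation is controlled by a
gradient in which each term pairs one ∇²f with one ∇f. Cauchy–Schwarz gives (1 + cos θ) ‖∇²f‖ ‖∇f‖,
and sin θ (1 + cos θ) integrates to 3/2 (`stein_discrepancy_stdGaussian`).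

A cylindrical variable is a function of the white noise on the span of its directions, a standard
Gaussian vector; restricting the second derivative to that span does not increase its operator norm.
The inequality is stable under the L⁴ limits that define 𝔻^{2,4}
(`IsMalliavin2.hasSteinDiscrepancyLE`).

For total variation, one solves the Stein equation with derivative at most 2. For Wasserstein, one
rotates F into an independent Gaussian: the velocity along the path is a Stein error whose test
function has been smoothed by the Gaussian. -/

lemma integrable_of_continuous_of_bound {α E : Type*} [TopologicalSpace α] [MeasurableSpace α]
    [OpensMeasurableSpace α] [SecondCountableTopology α] [NormedAddCommGroup E]
    {ν : Measure α} [IsFiniteMeasure ν] {f : α → E} (hf : Continuous f) {C : ℝ}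
    (hC : ∀ x, ‖f x‖ ≤ C) : Integrable f ν :=
  Integrable.of_bound hf.aestronglyMeasurable C (ae_of_all _ hC)

/-! ### Gaussian integration by parts, on the line and in Euclidean space. -/

/-- Gaussian integration by parts on the line. -/
lemma integral_mul_id_gaussianReal {g g' : ℝ → ℝ} (hg : ∀ t, HasDerivAt g (g' t) t)
    (hg' : Continuous g') {C C' : ℝ} (hC : ∀ t, |g t| ≤ C) (hC' : ∀ t, |g' t| ≤ C') :
    ∫ t, g t * t ∂gaussianReal 0 1 = ∫ t, g' t ∂gaussianReal 0 1 := by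
  have hgc : Continuous g := continuous_iff_continuousAt.2 fun t ↦ (hg t).continuousAt
  rw [integral_gaussianReal_eq_integral_smul one_ne_zero,
    integral_gaussianReal_eq_integral_smul one_ne_zero]
  set p := gaussianPDFReal 0 1 with hp
  -- The density satisfies p' = −x p, which reduces the claim to ordinary integration by parts.
  have hpd : ∀ x, HasDerivAt p (-(x * p x)) x := by
    intro x
    have h1 : HasDerivAt (fun x : ℝ ↦ -(x - 0) ^ 2 / (2 * ((1 : ℝ≥0) : ℝ))) (-x) x := by
      have := (((hasDerivAt_id x).sub_const 0).pow 2).neg.div_const (2 * ((1 : ℝ≥0) : ℝ))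
      refine this.congr_deriv ?_
      simp
      ring
    have h2 := h1.exp.const_mul (√(2 * Real.pi * ((1 : ℝ≥0) : ℝ)))⁻¹
    rw [hp, gaussianPDFReal_def]
    refine h2.congr_deriv ?_
    ring
  have hpi : Integrable p := integrable_gaussianPDFReal 0 1
  have hxp : Integrable (fun x ↦ x * p x) := by
    have := (integrable_mul_exp_neg_mul_sq (b := 1 / 2) (by norm_num)).const_mul
      (√(2 * Real.pi * ((1 : ℝ≥0) : ℝ)))⁻¹
    refine this.congr (ae_of_all _ fun x ↦ ?_)
    simp only [hp, gaussianPDFReal_def]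
    have : -(x - 0) ^ 2 / (2 * ((1 : ℝ≥0) : ℝ)) = -(1 / 2) * x ^ 2 := by simp; ring
    rw [this]; ring
  have key := integral_mul_deriv_eq_deriv_mul_of_integrable (u := g) (v := p) (u' := g')
    (v' := fun x ↦ -(x * p x)) (fun x _ ↦ hg x) (fun x _ ↦ hpd x)
    (hxp.neg.bdd_mul hgc.aestronglyMeasurable (ae_of_all _ hC))
    (hpi.bdd_mul hg'.aestronglyMeasurable (ae_of_all _ hC'))
    (hpi.bdd_mul hgc.aestronglyMeasurable (ae_of_all _ hC))
  have e1 : ∫ x, p x • (g x * x) = -∫ x, g x * -(x * p x) := by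
    rw [← integral_neg]; congr 1; ext x; simp; ring
  have e2 : ∫ x, p x • g' x = ∫ x, g' x * p x := by
    congr 1; ext x; simp; ring
  rw [e1, e2, key, neg_neg]

section Finite

variable {E : Type*} [NormedAddCommGroup E] [InnerProductSpace ℝ E] [FiniteDimensional ℝ E]
  [MeasurableSpace E] [BorelSpace E]

/-- The standard Gaussian measure splits as a product along a unit vector. -/
lemma map_prod_stdGaussian_gaussianReal {v : E} (hv : ‖v‖ = 1) :
    ((stdGaussian E).prod (gaussianReal 0 1)).map
      (fun q : E × ℝ ↦ (q.1 - ⟪v, q.1⟫_ℝ • v) + q.2 • v) = stdGaussian E := by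
  refine Measure.ext_of_charFun ?_
  ext t
  have hm : Measurable (fun q : E × ℝ ↦ (q.1 - ⟪v, q.1⟫_ℝ • v) + q.2 • v) := by fun_prop
  rw [charFun_apply, integral_map hm.aemeasurable (by fun_prop)]
  have : ∀ q : E × ℝ, Complex.exp (⟪(q.1 - ⟪v, q.1⟫_ℝ • v) + q.2 • v, t⟫_ℝ * Complex.I)
      = Complex.exp (⟪q.1, t - ⟪v, t⟫_ℝ • v⟫_ℝ * Complex.I) *
        Complex.exp (⟪q.2, ⟪v, t⟫_ℝ⟫_ℝ * Complex.I) := by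
    intro q
    rw [← Complex.exp_add]
    congr 1
    rw [← add_mul, ← Complex.ofReal_add]
    congr 2
    simp only [inner_add_left, inner_sub_left, inner_sub_right, real_inner_smul_left,
      real_inner_smul_right, RCLike.inner_apply, conj_trivial]
    rw [real_inner_comm v q.1]; ring
  simp_rw [this]
  rw [integral_prod_mul (fun x : E ↦ Complex.exp (⟪x, t - ⟪v, t⟫_ℝ • v⟫_ℝ * Complex.I))
    (fun s : ℝ ↦ Complex.exp (⟪s, ⟪v, t⟫_ℝ⟫_ℝ * Complex.I)), ← charFun_apply, ← charFun_apply,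
    charFun_stdGaussian, charFun_gaussianReal, charFun_stdGaussian, ← Complex.exp_add]
  congr 1
  -- Pythagoras: the two Gaussian exponents add up to that of t.
  have : ‖t - ⟪v, t⟫_ℝ • v‖ ^ 2 = ‖t‖ ^ 2 - ⟪v, t⟫_ℝ ^ 2 := by
    rw [norm_sub_sq_real, norm_smul, hv, real_inner_smul_right, real_inner_comm]
    simp; ring
  have h2 : ((‖t - ⟪v, t⟫_ℝ • v‖ : ℂ)) ^ 2 = (‖t‖ : ℂ) ^ 2 - (⟪v, t⟫_ℝ : ℂ) ^ 2 := by
    exact_mod_cast this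
  rw [h2]
  push_cast
  ring

/-- Gaussian integration by parts. -/
lemma integral_mul_inner_stdGaussian {w : E → ℝ} {gw : E → E}
    (hw : ∀ x, HasGradientAt w (gw x) x) (hgw : Continuous gw) {C C' : ℝ}
    (hC : ∀ x, |w x| ≤ C) (hC' : ∀ x, ‖gw x‖ ≤ C') (v : E) :
    ∫ x, w x * ⟪v, x⟫_ℝ ∂stdGaussian E = ∫ x, ⟪gw x, v⟫_ℝ ∂stdGaussian E := by
  have hwc : Continuous w := continuous_iff_continuousAt.2 fun t ↦ (hw t).continuousAt
  -- the case of unit vectors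
  have unit : ∀ v : E, ‖v‖ = 1 →
      ∫ x, w x * ⟪v, x⟫_ℝ ∂stdGaussian E = ∫ x, ⟪gw x, v⟫_ℝ ∂stdGaussian E := by
    intro v hv
    have hvv : ⟪v, v⟫_ℝ = 1 := by rw [real_inner_self_eq_norm_sq, hv]; norm_num
    set m : E × ℝ → E := fun q ↦ (q.1 - ⟪v, q.1⟫_ℝ • v) + q.2 • v with hm_def
    have hm : Continuous m := by fun_prop
    have hmap := map_prod_stdGaussian_gaussianReal (E := E) hv
    have hmp : MeasurePreserving m ((stdGaussian E).prod (gaussianReal 0 1)) (stdGaussian E) :=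
      ⟨hm.measurable, hmap⟩
    have hin : ∀ q, ⟪v, m q⟫_ℝ = q.2 := by
      intro q
      simp only [hm_def, inner_add_right, inner_sub_right, real_inner_smul_right, hvv]; ring
    have hI1 : Integrable (fun x ↦ w x * ⟪v, x⟫_ℝ) (stdGaussian E) := by
      refine Integrable.bdd_mul ?_ hwc.aestronglyMeasurable (ae_of_all _ hC)
      exact IsGaussian.integrable_dual _ (innerSL ℝ v)
    have hI2 : Integrable (fun x ↦ ⟪gw x, v⟫_ℝ) (stdGaussian E) :=
      integrable_of_continuous_of_bound (C := C') (by fun_prop) fun x ↦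
        (abs_real_inner_le_norm _ _).trans (by rw [hv, mul_one]; exact hC' x)
    have e1 : ∫ x, w x * ⟪v, x⟫_ℝ ∂stdGaussian E
        = ∫ q, w (m q) * q.2 ∂((stdGaussian E).prod (gaussianReal 0 1)) := by
      conv_lhs => rw [← hmap]
      rw [integral_map hm.aemeasurable]
      · simp only [hin]
      · rw [hmap]; exact hI1.aestronglyMeasurable
    have e2 : ∫ x, ⟪gw x, v⟫_ℝ ∂stdGaussian E
        = ∫ q, ⟪gw (m q), v⟫_ℝ ∂((stdGaussian E).prod (gaussianReal 0 1)) := by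
      conv_lhs => rw [← hmap]
      rw [integral_map hm.aemeasurable]
      rw [hmap]; exact hI2.aestronglyMeasurable
    -- With the first coordinate frozen, only the coordinate along v varies, and the one-dimensional
    -- formula applies.
    rw [e1, e2, integral_prod, integral_prod]
    · congr 1; ext x
      refine integral_mul_id_gaussianReal (C := C) (C' := C') (fun t ↦ ?_) ?_ (fun t ↦ hC _)
        fun t ↦ ?_
      · have h1 : HasDerivAt (fun t : ℝ ↦ m (x, t)) v t := by
          simpa [hm_def] using ((hasDerivAt_id t).smul_const v).const_add (x - ⟪v, x⟫_ℝ • v)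
        have := (hw (m (x, t))).hasFDerivAt.comp_hasDerivAt t h1
        exact this.congr_deriv (by simp)
      · fun_prop
      · exact (abs_real_inner_le_norm _ _).trans (by rw [hv, mul_one]; exact hC' _)
    · exact hmp.integrable_comp_of_integrable hI2
    · have := hmp.integrable_comp_of_integrable hI1
      refine this.congr (ae_of_all _ fun q ↦ ?_)
      simp [hin]
  rcases eq_or_ne v 0 with rfl | hv
  · simp
  have h := unit (‖v‖⁻¹ • v) (by rw [norm_smul]; simp [hv])
  have hn : ‖v‖⁻¹ ≠ 0 := by simpa using hv
  simp only [real_inner_smul_left, real_inner_smul_right] at h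
  simp_rw [mul_left_comm _ ‖v‖⁻¹] at h
  rw [integral_const_mul, integral_const_mul] at h
  exact mul_left_cancel₀ hn h

end Finite

lemma sq_integral_mul_le {α : Type*} [MeasurableSpace α] {ν : Measure α} {a b : α → ℝ}
    (ha : MemLp a 2 ν) (hb : MemLp b 2 ν) :
    (∫ x, a x * b x ∂ν) ^ 2 ≤ (∫ x, a x ^ 2 ∂ν) * ∫ x, b x ^ 2 ∂ν := by
  have hab : Integrable (fun x ↦ a x * b x) ν := ha.integrable_mul hb
  have ha2 := ha.integrable_sq
  have hb2 := hb.integrable_sq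
  -- Cauchy–Schwarz from the discriminant of the nonnegative quadratic ∫ (a t + b)².
  have h : ∀ t : ℝ, 0 ≤ (∫ x, a x ^ 2 ∂ν) * (t * t) + (2 * ∫ x, a x * b x ∂ν) * t
      + ∫ x, b x ^ 2 ∂ν := by
    intro t
    have : (∫ x, a x ^ 2 ∂ν) * (t * t) + (2 * ∫ x, a x * b x ∂ν) * t + ∫ x, b x ^ 2 ∂ν
        = ∫ x, (a x * t + b x) ^ 2 ∂ν := by
      have e : ∀ x, (a x * t + b x) ^ 2 = a x ^ 2 * (t * t) + (a x * b x) * (2 * t) + b x ^ 2 := by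
        intro x; ring
      simp_rw [e]
      have i1 : Integrable (fun x ↦ a x ^ 2 * (t * t) + a x * b x * (2 * t)) ν :=
        (ha2.mul_const _).add (hab.mul_const _)
      rw [integral_add i1 hb2, integral_add (ha2.mul_const _) (hab.mul_const _),
        integral_mul_const, integral_mul_const]
      ring
    rw [this]
    exact integral_nonneg fun x ↦ sq_nonneg _
  have := discrim_le_zero h
  rw [discrim] at this
  nlinarith

lemma sq_integral_le {α : Type*} [MeasurableSpace α] {ν : Measure α} [IsProbabilityMeasure ν]
    {a : α → ℝ} (ha : MemLp a 2 ν) : (∫ x, a x ∂ν) ^ 2 ≤ ∫ x, a x ^ 2 ∂ν := by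
  simpa using sq_integral_mul_le ha (memLp_const (1 : ℝ))

lemma memLp_of_continuous_of_bound {α E : Type*} [TopologicalSpace α] [MeasurableSpace α]
    [OpensMeasurableSpace α] [SecondCountableTopology α] [NormedAddCommGroup E]
    {ν : Measure α} [IsFiniteMeasure ν] {f : α → E} (hf : Continuous f) {C : ℝ}
    (hC : ∀ x, ‖f x‖ ≤ C) (p : ℝ≥0∞) : MemLp f p ν :=
  MemLp.of_bound hf.aestronglyMeasurable C (ae_of_all _ hC)

lemma continuous_of_hasGradientAt {E : Type*} [NormedAddCommGroup E] [InnerProductSpace ℝ E]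
    [CompleteSpace E] {u : E → ℝ} {gu : E → E}
    (hu : ∀ x, HasGradientAt u (gu x) x) : Continuous u :=
  continuous_iff_continuousAt.2 fun t ↦ (hu t).continuousAt

/-! ### Covariance by rotation, and the Gaussian Poincaré inequality. -/

section Finite

variable {E : Type*} [NormedAddCommGroup E] [InnerProductSpace ℝ E] [FiniteDimensional ℝ E]
  [MeasurableSpace E] [BorelSpace E]

local notation "γ" => stdGaussian E

lemma measurePreserving_rotation (θ : ℝ) :
    MeasurePreserving (ContinuousLinearMap.rotation θ : E × E →L[ℝ] E × E)
      ((γ).prod γ) ((γ).prod γ) :=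
  ⟨by fun_prop, IsGaussian.map_rotation_eq_self (by simp) θ⟩

lemma measurePreserving_rotation_fst (θ : ℝ) :
    MeasurePreserving (fun p : E × E ↦ Real.cos θ • p.1 + Real.sin θ • p.2) ((γ).prod γ) γ :=
  measurePreserving_fst.comp (measurePreserving_rotation θ)

lemma integrable_norm_add_norm_prod : Integrable (fun p : E × E ↦ ‖p.1‖ + ‖p.2‖) ((γ).prod γ) := by
  have h : Integrable (fun x : E ↦ ‖x‖) γ := IsGaussian.integrable_id.norm
  exact (h.comp_fst γ).add (h.comp_snd γ)

variable {u f : E → ℝ} {gu gf : E → E} {Cu Cf Du Df : ℝ}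

/-- The derivative of `θ ↦ E[u(x) f(cos θ x + sin θ y)]`. -/
lemma hasDerivAt_integral_mul_rotation (hu : ∀ x, HasGradientAt u (gu x) x)
    (hf : ∀ x, HasGradientAt f (gf x) x) (hgu : Continuous gu) (hgf : Continuous gf)
    (hCu : ∀ x, |u x| ≤ Cu) (hCf : ∀ x, |f x| ≤ Cf)
    (hDu : ∀ x, ‖gu x‖ ≤ Du) (hDf : ∀ x, ‖gf x‖ ≤ Df) (θ : ℝ) :
    HasDerivAt (fun θ ↦ ∫ p : E × E, u p.1 * f (Real.cos θ • p.1 + Real.sin θ • p.2) ∂(γ).prod γ)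
      (-(Real.sin θ * ∫ p : E × E, ⟪gu p.1, gf (Real.cos θ • p.1 + Real.sin θ • p.2)⟫_ℝ
        ∂(γ).prod γ)) θ := by
  have huc := continuous_of_hasGradientAt hu
  have hfc := continuous_of_hasGradientAt hf
  have hCu0 : 0 ≤ Cu := (abs_nonneg _).trans (hCu 0)
  have hDf0 : 0 ≤ Df := (norm_nonneg _).trans (hDf 0)
  -- The derivative in θ. The vector −sin θ x + cos θ y is the second rotated coordinate,
  -- independent of cos θ x + sin θ y.
  set F' : ℝ → E × E → ℝ := fun θ p ↦ u p.1 *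
    ⟪gf (Real.cos θ • p.1 + Real.sin θ • p.2), -Real.sin θ • p.1 + Real.cos θ • p.2⟫_ℝ with hF'
  have hF'b : ∀ θ p, ‖F' θ p‖ ≤ Cu * Df * (‖p.1‖ + ‖p.2‖) := by
    intro θ p
    rw [hF', norm_mul, mul_assoc]
    refine mul_le_mul (hCu _) ?_ (norm_nonneg _) hCu0
    refine (norm_inner_le_norm _ _).trans (mul_le_mul (hDf _) ?_ (norm_nonneg _) hDf0)
    refine (norm_add_le _ _).trans (add_le_add ?_ ?_)
    · rw [norm_smul, norm_neg]
      exact mul_le_of_le_one_left (norm_nonneg _) (Real.abs_sin_le_one θ)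
    · rw [norm_smul]
      exact mul_le_of_le_one_left (norm_nonneg _) (Real.abs_cos_le_one θ)
  have hF'int : ∀ θ, Integrable (F' θ) ((γ).prod γ) := fun θ ↦
    (integrable_norm_add_norm_prod.const_mul (Cu * Df)).mono'
      (Continuous.aestronglyMeasurable (by fun_prop)) (ae_of_all _ (hF'b θ))
  have hder := (hasDerivAt_integral_of_dominated_loc_of_deriv_le (μ := (γ).prod γ)
    (F := fun θ p ↦ u p.1 * f (Real.cos θ • p.1 + Real.sin θ • p.2)) (F' := F') (x₀ := θ)
    (s := Set.univ) (bound := fun p ↦ Cu * Df * (‖p.1‖ + ‖p.2‖)) univ_mem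
    (Eventually.of_forall fun θ ↦ Continuous.aestronglyMeasurable (by fun_prop))
    (integrable_of_continuous_of_bound (C := Cu * Cf) (by fun_prop) fun p ↦ by
      rw [norm_mul]; exact mul_le_mul (hCu _) (hCf _) (norm_nonneg _) hCu0)
    (hF'int θ).aestronglyMeasurable (ae_of_all _ fun p θ _ ↦ hF'b θ p)
    (integrable_norm_add_norm_prod.const_mul _)
    (ae_of_all _ fun p θ _ ↦ by
      have h1 : HasDerivAt (fun θ ↦ Real.cos θ • p.1 + Real.sin θ • p.2)
          (-Real.sin θ • p.1 + Real.cos θ • p.2) θ :=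
        ((Real.hasDerivAt_cos θ).smul_const _).add ((Real.hasDerivAt_sin θ).smul_const _)
      have h2 := ((hf _).hasFDerivAt.comp_hasDerivAt θ h1).const_mul (u p.1)
      exact h2.congr_deriv (by simp [hF']))).2
  refine hder.congr_deriv ?_
  -- pass to the rotated variables, integrate by parts in the second one, and rotate back
  set G : E × E → ℝ := fun q ↦ u (Real.cos θ • q.1 - Real.sin θ • q.2) * ⟪gf q.1, q.2⟫_ℝ with hG
  have hback : ∀ p : E × E, Real.cos θ • (Real.cos θ • p.1 + Real.sin θ • p.2)
      - Real.sin θ • (-Real.sin θ • p.1 + Real.cos θ • p.2) = p.1 := by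
    intro p
    have := Real.cos_sq_add_sin_sq θ
    have e : Real.cos θ • (Real.cos θ • p.1 + Real.sin θ • p.2)
      - Real.sin θ • (-Real.sin θ • p.1 + Real.cos θ • p.2)
        = (Real.cos θ ^ 2 + Real.sin θ ^ 2) • p.1 := by module
    rw [e, this, one_smul]
  have hrot : ∀ φ : E × E → ℝ, Continuous φ →
      ∫ p, φ (ContinuousLinearMap.rotation θ p) ∂(γ).prod γ = ∫ q, φ q ∂(γ).prod γ := by
    intro φ hφ
    conv_rhs => rw [← (measurePreserving_rotation (E := E) θ).map_eq]
    rw [integral_map (by fun_prop) hφ.aestronglyMeasurable]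
  have e1 : ∫ p, F' θ p ∂(γ).prod γ = ∫ q, G q ∂(γ).prod γ := by
    rw [← hrot G (by fun_prop)]
    congr 1; ext p
    simp only [hF', hG, ContinuousLinearMap.rotation_apply, hback]
  have e2 : ∫ p : E × E, ⟪gu p.1, gf (Real.cos θ • p.1 + Real.sin θ • p.2)⟫_ℝ ∂(γ).prod γ
      = ∫ q : E × E, ⟪gu (Real.cos θ • q.1 - Real.sin θ • q.2), gf q.1⟫_ℝ ∂(γ).prod γ := by
    rw [← hrot (fun q : E × E ↦ ⟪gu (Real.cos θ • q.1 - Real.sin θ • q.2), gf q.1⟫_ℝ)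
      (by fun_prop)]
    simp only [ContinuousLinearMap.rotation_apply, hback]
  have hGint : Integrable G ((γ).prod γ) := by
    refine (integrable_norm_add_norm_prod.const_mul (Cu * Df)).mono'
      (Continuous.aestronglyMeasurable (by fun_prop)) (ae_of_all _ fun q ↦ ?_)
    rw [hG, norm_mul, mul_assoc]
    refine mul_le_mul (hCu _) ?_ (norm_nonneg _) hCu0
    refine (norm_inner_le_norm _ _).trans (mul_le_mul (hDf _) ?_ (norm_nonneg _) hDf0)
    linarith [norm_nonneg q.1]
  have hRint : Integrable
      (fun q : E × E ↦ ⟪gu (Real.cos θ • q.1 - Real.sin θ • q.2), gf q.1⟫_ℝ) ((γ).prod γ) :=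
    integrable_of_continuous_of_bound (C := Du * Df) (by fun_prop) fun q ↦
      (norm_inner_le_norm _ _).trans
        (mul_le_mul (hDu _) (hDf _) (norm_nonneg _) ((norm_nonneg _).trans (hDu 0)))
  rw [e1, e2, integral_prod _ hGint, integral_prod _ hRint, ← integral_const_mul, ← integral_neg]
  congr 1; ext a
  have hw : ∀ b, HasGradientAt (fun b ↦ u (Real.cos θ • a - Real.sin θ • b))
      (-Real.sin θ • gu (Real.cos θ • a - Real.sin θ • b)) b := by
    intro b
    rw [hasGradientAt_iff_hasFDerivAt]
    have h1 : HasFDerivAt (fun b : E ↦ Real.cos θ • a - Real.sin θ • b)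
        (-(Real.sin θ • ContinuousLinearMap.id ℝ E)) b :=
      ((hasFDerivAt_id b).const_smul (Real.sin θ)).const_sub _
    refine ((hu _).hasFDerivAt.comp b h1).congr_fderiv ?_
    ext v
    simp
  -- With the first rotated coordinate a fixed, `gf a` is a constant vector, so integrating by parts
  -- in b differentiates only u and produces the factor −sin θ.
  have := integral_mul_inner_stdGaussian (C := Cu) (C' := |Real.sin θ| * Du) hw (by fun_prop)
    (fun b ↦ hCu _) (fun b ↦ by
      rw [norm_smul, norm_neg]
      exact mul_le_mul_of_nonneg_left (hDu _) (abs_nonneg _)) (gf a)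
  simp only [hG]
  rw [this, ← integral_const_mul, ← integral_neg]
  congr 1; ext b
  simp [inner_smul_left]

lemma continuous_integral_inner_rotation (hgu : Continuous gu) (hgf : Continuous gf)
    (hDu : ∀ x, ‖gu x‖ ≤ Du) (hDf : ∀ x, ‖gf x‖ ≤ Df) :
    Continuous fun θ ↦ ∫ p : E × E, ⟪gu p.1, gf (Real.cos θ • p.1 + Real.sin θ • p.2)⟫_ℝ
      ∂(γ).prod γ := by
  refine continuous_of_dominated (bound := fun _ ↦ Du * Df)
    (fun θ ↦ Continuous.aestronglyMeasurable (by fun_prop))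
    (fun θ ↦ ae_of_all _ fun p ↦ (norm_inner_le_norm _ _).trans
        (mul_le_mul (hDu _) (hDf _) (norm_nonneg _) ((norm_nonneg _).trans (hDu 0))))
    (integrable_const _) (ae_of_all _ fun p ↦ by fun_prop)

/-- The covariance of two functions of a standard Gaussian vector in terms of their gradients. -/
lemma integral_mul_sub_eq_integral_inner (hu : ∀ x, HasGradientAt u (gu x) x)
    (hf : ∀ x, HasGradientAt f (gf x) x) (hgu : Continuous gu) (hgf : Continuous gf)
    (hCu : ∀ x, |u x| ≤ Cu) (hCf : ∀ x, |f x| ≤ Cf)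
    (hDu : ∀ x, ‖gu x‖ ≤ Du) (hDf : ∀ x, ‖gf x‖ ≤ Df) :
    ∫ x, u x * f x ∂γ - (∫ x, u x ∂γ) * ∫ x, f x ∂γ =
      ∫ θ in (0 : ℝ)..(Real.pi / 2), Real.sin θ *
        ∫ p : E × E, ⟪gu p.1, gf (Real.cos θ • p.1 + Real.sin θ • p.2)⟫_ℝ ∂(γ).prod γ := by
  -- At θ = 0 the interpolation is E[u f]; at θ = π/2 the two arguments are independent and it
  -- factors.
  have h := intervalIntegral.integral_eq_sub_of_hasDerivAt (a := 0) (b := Real.pi / 2)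
    (fun θ _ ↦ hasDerivAt_integral_mul_rotation hu hf hgu hgf hCu hCf hDu hDf θ)
    ((Real.continuous_sin.mul
      (continuous_integral_inner_rotation hgu hgf hDu hDf)).neg.intervalIntegrable _ _)
  rw [intervalIntegral.integral_neg] at h
  simp only [Real.cos_pi_div_two, Real.sin_pi_div_two, Real.cos_zero, Real.sin_zero, zero_smul,
    one_smul, zero_add, add_zero] at h
  rw [integral_prod_mul u f, integral_fun_fst (fun x : E ↦ u x * f x)] at h
  simp only [probReal_univ, one_smul] at h
  linarith

/-- The Gaussian Poincaré inequality. -/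
lemma integral_sq_sub_le_integral_norm_gradient_sq (hf : ∀ x, HasGradientAt f (gf x) x)
    (hgf : Continuous gf) (hCf : ∀ x, |f x| ≤ Cf) (hDf : ∀ x, ‖gf x‖ ≤ Df) :
    ∫ x, (f x - ∫ z, f z ∂γ) ^ 2 ∂γ ≤ ∫ x, ‖gf x‖ ^ 2 ∂γ := by
  have hfc := continuous_of_hasGradientAt hf
  have hDf0 : 0 ≤ Df := (norm_nonneg _).trans (hDf 0)
  have hfi : Integrable f γ := integrable_of_continuous_of_bound hfc hCf
  have hfi2 : Integrable (fun x ↦ f x * f x) γ := hfi.bdd_mul hfc.aestronglyMeasurable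
    (ae_of_all _ hCf)
  have e : ∫ x, (f x - ∫ z, f z ∂γ) ^ 2 ∂γ
      = ∫ x, f x * f x ∂γ - (∫ x, f x ∂γ) * ∫ x, f x ∂γ := by
    have : ∀ x, (f x - ∫ z, f z ∂γ) ^ 2
        = (f x * f x - 2 * (∫ z, f z ∂γ) * f x) + (∫ z, f z ∂γ) ^ 2 := by intro x; ring
    simp_rw [this]
    have i1 : Integrable (fun x ↦ f x * f x - 2 * (∫ z, f z ∂γ) * f x) γ :=
      hfi2.sub (hfi.const_mul _)
    rw [integral_add i1 (integrable_const _), integral_sub hfi2 (hfi.const_mul _), integral_const_mul]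
    simp; ring
  rw [e, integral_mul_sub_eq_integral_inner hf hf hgf hgf hCf hCf hDf hDf]
  have hg2 : Integrable (fun x ↦ ‖gf x‖ ^ 2) γ :=
    integrable_of_continuous_of_bound (C := Df ^ 2) (by fun_prop) fun x ↦ by
      simpa using pow_le_pow_left₀ (norm_nonneg _) (hDf x) 2
  -- Both gradients have the same L² norm since the rotated point is again standard Gaussian; 2⟨a,
  -- b⟩ ≤ ‖a‖² + ‖b‖² suffices, and sin θ has integral 1.
  have hpt : ∀ θ ∈ Set.Icc 0 (Real.pi / 2), Real.sin θ *
      (∫ p : E × E, ⟪gf p.1, gf (Real.cos θ • p.1 + Real.sin θ • p.2)⟫_ℝ ∂(γ).prod γ)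
        ≤ Real.sin θ * ∫ x, ‖gf x‖ ^ 2 ∂γ := by
    intro θ hθ
    refine mul_le_mul_of_nonneg_left ?_
      (Real.sin_nonneg_of_nonneg_of_le_pi hθ.1 (by linarith [hθ.2, Real.pi_pos]))
    have hmp := measurePreserving_rotation_fst (E := E) θ
    have i1 : Integrable (fun p : E × E ↦ ‖gf p.1‖ ^ 2) ((γ).prod γ) := hg2.comp_fst γ
    have i2 : Integrable (fun p : E × E ↦ ‖gf (Real.cos θ • p.1 + Real.sin θ • p.2)‖ ^ 2)
      ((γ).prod γ) := hmp.integrable_comp_of_integrable hg2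
    calc _ ≤ ∫ p : E × E, (1 / 2 * ‖gf p.1‖ ^ 2
          + 1 / 2 * ‖gf (Real.cos θ • p.1 + Real.sin θ • p.2)‖ ^ 2) ∂(γ).prod γ := by
          refine integral_mono ?_ ((i1.const_mul _).add (i2.const_mul _)) fun p ↦ ?_
          · exact integrable_of_continuous_of_bound (C := Df * Df) (by fun_prop) fun q ↦
              (norm_inner_le_norm _ _).trans (mul_le_mul (hDf _) (hDf _) (norm_nonneg _) hDf0)
          · have := real_inner_le_norm (gf p.1) (gf (Real.cos θ • p.1 + Real.sin θ • p.2))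
            dsimp only
            nlinarith [sq_nonneg (‖gf p.1‖ - ‖gf (Real.cos θ • p.1 + Real.sin θ • p.2)‖)]
      _ = ∫ x, ‖gf x‖ ^ 2 ∂γ := by
          rw [integral_add (i1.const_mul _) (i2.const_mul _), integral_const_mul,
            integral_const_mul, integral_fun_fst (fun x : E ↦ ‖gf x‖ ^ 2)]
          have : ∫ p : E × E, ‖gf (Real.cos θ • p.1 + Real.sin θ • p.2)‖ ^ 2 ∂(γ).prod γ
              = ∫ x, ‖gf x‖ ^ 2 ∂γ := by
            conv_rhs => rw [← hmp.map_eq]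
            rw [integral_map hmp.aemeasurable (by rw [hmp.map_eq]; exact hg2.aestronglyMeasurable)]
          rw [this]; simp; ring
  calc _ ≤ ∫ θ in (0 : ℝ)..(Real.pi / 2), Real.sin θ * ∫ x, ‖gf x‖ ^ 2 ∂γ :=
        intervalIntegral.integral_mono_on (by positivity)
          ((Real.continuous_sin.mul
            (continuous_integral_inner_rotation hgf hgf hDf hDf)).intervalIntegrable _ _)
          ((Real.continuous_sin.mul continuous_const).intervalIntegrable _ _) hpt
    _ = _ := by simp

end Finite

/-! ### Stein's identity with an error term for functions of a Gaussian vector. -/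

/-- The gradient in `x` of `⟨g(x), g(c x + s y)⟩`. -/
lemma hasGradientAt_inner_mix {E : Type*} [NormedAddCommGroup E] [InnerProductSpace ℝ E]
    [CompleteSpace E] {g : E → E} {A : E → E →L[ℝ] E} (hg : ∀ x, HasFDerivAt g (A x) x) (c s : ℝ) (x y : E) :
    HasGradientAt (fun x ↦ ⟪g x, g (c • x + s • y)⟫_ℝ)
      (ContinuousLinearMap.adjoint (A x) (g (c • x + s • y)) +
        c • ContinuousLinearMap.adjoint (A (c • x + s • y)) (g x)) x := by
  rw [hasGradientAt_iff_hasFDerivAt]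
  have h1 : HasFDerivAt (fun x : E ↦ c • x + s • y) (c • ContinuousLinearMap.id ℝ E) x :=
    ((hasFDerivAt_id x).const_smul c).add_const _
  have h2 := (hg x).inner ℝ ((hg (c • x + s • y)).comp x h1)
  refine h2.congr_fderiv ?_
  ext v
  simp [inner_smul_right, ContinuousLinearMap.adjoint_inner_left, real_inner_comm]
  ring

section Finite

variable {E : Type*} [NormedAddCommGroup E] [InnerProductSpace ℝ E] [FiniteDimensional ℝ E]
  [MeasurableSpace E] [BorelSpace E]

local notation "γ" => stdGaussian E

/-- Poincaré inequality for an average `∫ W(·, y) dν(y)`. -/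
lemma integral_sq_sub_integral_le {W : E → E → ℝ} {gW : E → E → E} {C D : ℝ}
    (hW : ∀ x y, HasGradientAt (fun x ↦ W x y) (gW x y) x)
    (hWc : Continuous (Function.uncurry W)) (hgW : Continuous (Function.uncurry gW))
    (hC : ∀ x y, |W x y| ≤ C) (hD : ∀ x y, ‖gW x y‖ ≤ D) :
    ∫ x, ((∫ y, W x y ∂γ) - ∫ z, ∫ y, W z y ∂γ ∂γ) ^ 2 ∂γ
      ≤ ∫ p : E × E, ‖gW p.1 p.2‖ ^ 2 ∂(γ).prod γ := by
  have hgWx : ∀ x, Continuous (gW x) := fun x ↦ hgW.comp (by fun_prop : Continuous fun y ↦ (x, y))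
  have hWx : ∀ x, Continuous (W x) := fun x ↦ hWc.comp (by fun_prop : Continuous fun y ↦ (x, y))
  have hgWy : ∀ y, Continuous (gW · y) := fun y ↦
    hgW.comp (by fun_prop : Continuous fun x ↦ (x, y))
  have hgWi : ∀ x, Integrable (gW x) γ := fun x ↦
    integrable_of_continuous_of_bound (hgWx x) (hD x)
  have hS : ∀ x, HasGradientAt (fun x ↦ ∫ y, W x y ∂γ) (∫ y, gW x y ∂γ) x := by
    intro x
    rw [hasGradientAt_iff_hasFDerivAt]
    have hmeas : Continuous fun y ↦ InnerProductSpace.toDual ℝ E (gW x y) :=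
      (InnerProductSpace.toDual ℝ E).continuous.comp (hgWx x)
    have hn : ∀ x y, ‖InnerProductSpace.toDual ℝ E (gW x y)‖ ≤ D := fun x y ↦ by simpa using hD x y
    have := hasFDerivAt_integral_of_dominated_of_fderiv_le (μ := γ) (𝕜 := ℝ) (F := W)
      (F' := fun x y ↦ InnerProductSpace.toDual ℝ E (gW x y)) (x₀ := x) (s := Set.univ)
      (bound := fun _ ↦ D) univ_mem
      (Eventually.of_forall fun x ↦ (hWx x).aestronglyMeasurable)
      (integrable_of_continuous_of_bound (hWx x) (hC x)) hmeas.aestronglyMeasurable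
      (ae_of_all _ fun y x _ ↦ hn x y) (integrable_const _)
      (ae_of_all _ fun y x _ ↦ (hW x y).hasFDerivAt)
    refine this.congr_fderiv ?_
    ext v
    rw [ContinuousLinearMap.integral_apply (integrable_of_continuous_of_bound hmeas (hn x))]
    simp only [InnerProductSpace.toDual_apply_apply]
    rw [real_inner_comm, ← integral_inner (hgWi x)]
    simp_rw [real_inner_comm]
  have hSc : Continuous fun x ↦ ∫ y, gW x y ∂γ :=
    continuous_of_dominated (bound := fun _ ↦ D) (fun x ↦ (hgWx x).aestronglyMeasurable)
      (fun x ↦ ae_of_all _ (hD x)) (integrable_const _) (ae_of_all _ hgWy)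
  have hCS : ∀ x, |∫ y, W x y ∂γ| ≤ C := fun x ↦ by
    simpa using norm_integral_le_of_norm_le_const (μ := γ) (f := W x) (ae_of_all _ (hC x))
  have hDS : ∀ x, ‖∫ y, gW x y ∂γ‖ ≤ D := fun x ↦ by
    simpa using norm_integral_le_of_norm_le_const (μ := γ) (f := gW x) (ae_of_all _ (hD x))
  -- Poincaré for the average, then Jensen to move the square inside the integral over y.
  refine (integral_sq_sub_le_integral_norm_gradient_sq hS hSc hCS hDS).trans ?_
  have hsq : ∀ x y, ‖‖gW x y‖ ^ 2‖ ≤ D ^ 2 := fun x y ↦ by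
    simpa using pow_le_pow_left₀ (norm_nonneg _) (hD x y) 2
  have hi : Integrable (fun p : E × E ↦ ‖gW p.1 p.2‖ ^ 2) ((γ).prod γ) :=
    integrable_of_continuous_of_bound (C := D ^ 2) (hgW.norm.pow 2) fun p ↦ hsq _ _
  rw [integral_prod _ hi]
  refine integral_mono ?_ hi.integral_prod_left fun x ↦ ?_
  · exact integrable_of_continuous_of_bound (C := D ^ 2) (by fun_prop) fun x ↦ by
      simpa using pow_le_pow_left₀ (norm_nonneg _) (hDS x) 2
  · refine (pow_le_pow_left₀ (norm_nonneg _) (norm_integral_le_integral_norm _) 2).trans ?_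
    exact sq_integral_le (memLp_of_continuous_of_bound (C := D) (hgWx x).norm
      (by simpa using hD x) 2)

variable {f : E → ℝ} {g : E → E} {A : E → E →L[ℝ] E} {Cf Cg CA : ℝ}

/-- This is the second order estimate: each term of the gradient is a second derivative applied to a
first derivative, evaluated at two standard Gaussian points, so Cauchy–Schwarz separates them into
fourth moments. Keeping the weight cos θ on the second term gives the factor 1 + cos θ. -/
lemma integral_norm_gradient_inner_mix_sq_le (hgc : Continuous g) (hA : Continuous A)
    (hCg : ∀ x, ‖g x‖ ≤ Cg) (hCA : ∀ x, ‖A x‖ ≤ CA) {K : ℝ}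
    (hK4 : (∫ x, ‖A x‖ ^ 4 ∂γ) * ∫ x, ‖g x‖ ^ 4 ∂γ ≤ K ^ 4) {θ : ℝ} (hθ : 0 ≤ Real.cos θ) :
    ∫ p : E × E, ‖ContinuousLinearMap.adjoint (A p.1) (g (Real.cos θ • p.1 + Real.sin θ • p.2)) +
        Real.cos θ • ContinuousLinearMap.adjoint (A (Real.cos θ • p.1 + Real.sin θ • p.2))
          (g p.1)‖ ^ 2 ∂(γ).prod γ ≤ ((1 + Real.cos θ) * K) ^ 2 := by
  set c := Real.cos θ with hc
  set r : E × E → E := fun p ↦ c • p.1 + Real.sin θ • p.2 with hr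
  have hrc : Continuous r := by fun_prop
  have hmp : MeasurePreserving r ((γ).prod γ) γ := measurePreserving_rotation_fst θ
  have hCg0 : 0 ≤ Cg := (norm_nonneg _).trans (hCg 0)
  have hCA0 : 0 ≤ CA := (norm_nonneg _).trans (hCA 0)
  -- Cauchy–Schwarz for a product of functions of two standard Gaussian vectors
  have cs : ∀ q q' : E × E → E, MeasurePreserving q ((γ).prod γ) γ →
      MeasurePreserving q' ((γ).prod γ) γ → Continuous q → Continuous q' →
      ∫ p : E × E, ‖A (q p)‖ ^ 2 * ‖g (q' p)‖ ^ 2 ∂(γ).prod γ ≤ K ^ 2 := by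
    intro q q' hq hq' hqc hqc'
    have h := sq_integral_mul_le (ν := (γ).prod γ)
      (a := fun p : E × E ↦ ‖A (q p)‖ ^ 2) (b := fun p : E × E ↦ ‖g (q' p)‖ ^ 2)
      (memLp_of_continuous_of_bound (C := CA ^ 2) (by fun_prop) (fun p ↦ by
        simpa using pow_le_pow_left₀ (norm_nonneg _) (hCA (q p)) 2) 2)
      (memLp_of_continuous_of_bound (C := Cg ^ 2) (by fun_prop) (fun p ↦ by
        simpa using pow_le_pow_left₀ (norm_nonneg _) (hCg (q' p)) 2) 2)
    have e1 : ∫ p : E × E, (‖A (q p)‖ ^ 2) ^ 2 ∂(γ).prod γ = ∫ x, ‖A x‖ ^ 4 ∂γ := by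
      conv_rhs => rw [← hq.map_eq]
      rw [integral_map hq.aemeasurable (Continuous.aestronglyMeasurable (by fun_prop))]
      simp_rw [← pow_mul]
    have e2 : ∫ p : E × E, (‖g (q' p)‖ ^ 2) ^ 2 ∂(γ).prod γ = ∫ x, ‖g x‖ ^ 4 ∂γ := by
      conv_rhs => rw [← hq'.map_eq]
      rw [integral_map hq'.aemeasurable (Continuous.aestronglyMeasurable (by fun_prop))]
      simp_rw [← pow_mul]
    rw [e1, e2] at h
    refine abs_le_of_sq_le_sq' (h.trans (hK4.trans_eq (by ring))) (by positivity) |>.2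
  have hint : ∀ q q' : E × E → E, Continuous q → Continuous q' →
      Integrable (fun p : E × E ↦ ‖A (q p)‖ ^ 2 * ‖g (q' p)‖ ^ 2) ((γ).prod γ) := by
    intro q q' hq hq'
    refine integrable_of_continuous_of_bound (C := CA ^ 2 * Cg ^ 2) (by fun_prop) fun p ↦ ?_
    simp only [norm_mul, norm_pow, norm_norm]
    gcongr
    · exact hCA _
    · exact hCg _
  have h1 := cs Prod.fst r measurePreserving_fst hmp continuous_fst hrc
  have h2 := cs r Prod.fst hmp measurePreserving_fst hrc continuous_fst
  have i1 := hint Prod.fst r continuous_fst hrc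
  have i2 := hint r Prod.fst hrc continuous_fst
  -- Convexity in the form (a + c b)² ≤ (1 + c)(a² + c b²), whose defect is c (a − b)².
  have hpt : ∀ p : E × E, ‖ContinuousLinearMap.adjoint (A p.1) (g (r p)) +
        c • ContinuousLinearMap.adjoint (A (r p)) (g p.1)‖ ^ 2
      ≤ (1 + c) * (‖A p.1‖ ^ 2 * ‖g (r p)‖ ^ 2) + (1 + c) * c * (‖A (r p)‖ ^ 2 * ‖g p.1‖ ^ 2) := by
    intro p
    have hadj : ∀ (B : E →L[ℝ] E) (z : E), ‖ContinuousLinearMap.adjoint B z‖ ≤ ‖B‖ * ‖z‖ :=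
      fun B z ↦ ((ContinuousLinearMap.adjoint B).le_opNorm z).trans_eq (by
        rw [LinearIsometryEquiv.norm_map])
    have ha := hadj (A p.1) (g (r p))
    have hb := hadj (A (r p)) (g p.1)
    have hn : ‖ContinuousLinearMap.adjoint (A p.1) (g (r p)) +
        c • ContinuousLinearMap.adjoint (A (r p)) (g p.1)‖
        ≤ ‖A p.1‖ * ‖g (r p)‖ + c * (‖A (r p)‖ * ‖g p.1‖) := by
      refine (norm_add_le _ _).trans (add_le_add ha ?_)
      rw [norm_smul, Real.norm_of_nonneg hθ]
      exact mul_le_mul_of_nonneg_left hb hθ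
    refine (pow_le_pow_left₀ (norm_nonneg _) hn 2).trans ?_
    nlinarith [mul_nonneg hθ (sq_nonneg (‖A p.1‖ * ‖g (r p)‖ - ‖A (r p)‖ * ‖g p.1‖))]
  calc _ ≤ ∫ p : E × E, ((1 + c) * (‖A p.1‖ ^ 2 * ‖g (r p)‖ ^ 2)
        + (1 + c) * c * (‖A (r p)‖ ^ 2 * ‖g p.1‖ ^ 2)) ∂(γ).prod γ :=
        integral_mono_of_nonneg (ae_of_all _ fun p ↦ by positivity)
          ((i1.const_mul _).add (i2.const_mul _)) (ae_of_all _ hpt)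
    _ ≤ (1 + c) * K ^ 2 + (1 + c) * c * K ^ 2 := by
        rw [integral_add (i1.const_mul _) (i2.const_mul _), integral_const_mul,
          integral_const_mul]
        gcongr
    _ = _ := by ring

/-- Covariance of a bounded function with a function of controlled variance. -/
lemma abs_integral_mul_sub_le {α : Type*} [MeasurableSpace α] {ν : Measure α}
    [IsProbabilityMeasure ν] {ψ S : α → ℝ} {M V : ℝ} (hψ : AEStronglyMeasurable ψ ν)
    (hM : ∀ x, |ψ x| ≤ M) (hS : MemLp S 2 ν) (hV0 : 0 ≤ V)
    (hV : ∫ x, (S x - ∫ z, S z ∂ν) ^ 2 ∂ν ≤ V ^ 2) :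
    |∫ x, ψ x * S x ∂ν - (∫ x, ψ x ∂ν) * ∫ x, S x ∂ν| ≤ M * V := by
  obtain ⟨x₀⟩ := nonempty_of_isProbabilityMeasure ν
  have hM0 : 0 ≤ M := (abs_nonneg _).trans (hM x₀)
  have hSi : Integrable S ν := hS.integrable one_le_two
  have hψi : Integrable ψ ν := Integrable.of_bound hψ M (ae_of_all _ hM)
  have hS' : MemLp (fun x ↦ S x - ∫ z, S z ∂ν) 2 ν := hS.sub (memLp_const _)
  have e : ∫ x, ψ x * S x ∂ν - (∫ x, ψ x ∂ν) * ∫ x, S x ∂ν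
      = ∫ x, ψ x * (S x - ∫ z, S z ∂ν) ∂ν := by
    simp_rw [mul_sub]
    rw [integral_sub (hSi.bdd_mul hψ (ae_of_all _ hM)) (hψi.mul_const _), integral_mul_const]
  rw [e]
  have hψ2 : MemLp ψ 2 ν := MemLp.of_bound hψ M (ae_of_all _ hM)
  have h := sq_integral_mul_le hψ2 hS'
  have hψM : ∫ x, ψ x ^ 2 ∂ν ≤ M ^ 2 := by
    have := integral_mono hψ2.integrable_sq (integrable_const (M ^ 2)) fun x ↦ by
      simpa using pow_le_pow_left₀ (abs_nonneg _) (hM x) 2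
    simpa using this
  refine abs_le_of_sq_le_sq (h.trans ?_) (by positivity)
  rw [mul_pow]
  exact mul_le_mul hψM hV (integral_nonneg fun x ↦ sq_nonneg _) (sq_nonneg _)

/-- A quantitative Stein identity for smooth functions of a standard Gaussian vector. -/
lemma stein_discrepancy_stdGaussian (hf : ∀ x, HasGradientAt f (g x) x)
    (hg : ∀ x, HasFDerivAt g (A x) x) (hA : Continuous A) (hCf : ∀ x, |f x| ≤ Cf)
    (hCg : ∀ x, ‖g x‖ ≤ Cg) (hCA : ∀ x, ‖A x‖ ≤ CA) {K : ℝ} (hK : 0 ≤ K)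
    (hK4 : (∫ x, ‖A x‖ ^ 4 ∂γ) * ∫ x, ‖g x‖ ^ 4 ∂γ ≤ K ^ 4)
    {h h' : ℝ → ℝ} (hh : ∀ z, HasDerivAt h (h' z) z) (hh' : Continuous h') {M : ℝ}
    (hM : ∀ z, |h' z| ≤ M) :
    |∫ x, h (f x) * (f x - ∫ z, f z ∂γ) ∂γ
      - (∫ x, (f x - ∫ z, f z ∂γ) ^ 2 ∂γ) * ∫ x, h' (f x) ∂γ| ≤ M * (3 / 2 * K) := by
  have hgc : Continuous g := continuous_iff_continuousAt.2 fun t ↦ (hg t).continuousAt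
  have hfc : Continuous f := continuous_of_hasGradientAt hf
  have hhc : Continuous h := continuous_iff_continuousAt.2 fun t ↦ (hh t).continuousAt
  have hM0 : 0 ≤ M := (abs_nonneg _).trans (hM 0)
  have hCg0 : 0 ≤ Cg := (norm_nonneg _).trans (hCg 0)
  have hCA0 : 0 ≤ CA := (norm_nonneg _).trans (hCA 0)
  -- The test function h may be unbounded, but f takes its values in a compact interval.
  obtain ⟨Ch, hCh⟩ : ∃ Ch, ∀ x, |h (f x)| ≤ Ch := by
    obtain ⟨C, hC⟩ := (isCompact_Icc (a := -Cf) (b := Cf)).exists_bound_of_continuousOn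
      hhc.continuousOn
    exact ⟨C, fun x ↦ hC _ (abs_le.1 (hCf x))⟩
  have hfi : Integrable f γ := integrable_of_continuous_of_bound hfc hCf
  have hhf : Integrable (fun x ↦ h (f x)) γ :=
    integrable_of_continuous_of_bound (by fun_prop) hCh
  have hff : Integrable (fun x ↦ f x * f x) γ :=
    hfi.bdd_mul hfc.aestronglyMeasurable (ae_of_all _ hCf)
  have hhff : Integrable (fun x ↦ h (f x) * f x) γ :=
    hfi.bdd_mul hhf.aestronglyMeasurable (ae_of_all _ hCh)
  have hgrad : ∀ x, HasGradientAt (fun x ↦ h (f x)) (h' (f x) • g x) x := by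
    intro x
    rw [hasGradientAt_iff_hasFDerivAt]
    refine ((hh (f x)).comp_hasFDerivAt x (hf x).hasFDerivAt).congr_fderiv ?_
    ext v; simp
  have hDh : ∀ x, ‖h' (f x) • g x‖ ≤ M * Cg := fun x ↦ by
    rw [norm_smul]
    exact mul_le_mul (hM _) (hCg _) (norm_nonneg _) hM0
  have c1 := integral_mul_sub_eq_integral_inner hgrad hf (by fun_prop) hgc hCh hCf hDh hCg
  have c2 := integral_mul_sub_eq_integral_inner hf hf hgc hgc hCf hCf hCg hCg
  set m := ∫ z, f z ∂γ with hm
  have e1 : ∫ x, h (f x) * (f x - m) ∂γ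
      = ∫ x, h (f x) * f x ∂γ - (∫ x, h (f x) ∂γ) * m := by
    simp_rw [mul_sub]
    rw [integral_sub hhff (hhf.mul_const _), integral_mul_const]
  have e2 : ∫ x, (f x - m) ^ 2 ∂γ = ∫ x, f x * f x ∂γ - m * m := by
    have : ∀ x, (f x - m) ^ 2 = (f x * f x - 2 * m * f x) + m ^ 2 := by intro x; ring
    simp_rw [this]
    have i1 : Integrable (fun x ↦ f x * f x - 2 * m * f x) γ := hff.sub (hfi.const_mul _)
    rw [integral_add i1 (integrable_const _), integral_sub hff (hfi.const_mul _),
      integral_const_mul, ← hm]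
    simp; ring
  rw [e1, e2, c1, c2, ← intervalIntegral.integral_mul_const, ← intervalIntegral.integral_sub]
  rotate_left
  · exact (Real.continuous_sin.mul (continuous_integral_inner_rotation (by fun_prop) hgc hDh
      hCg)).intervalIntegrable _ _
  · exact ((Real.continuous_sin.mul (continuous_integral_inner_rotation hgc hgc hCg
      hCg)).mul continuous_const).intervalIntegrable _ _
  -- The integrand is sin θ times the covariance of h'(f) with the average of W over y. The first is
  -- bounded by M and the second has standard deviation at most (1 + cos θ) K.
  have hbound : ∀ θ ∈ Set.Ioc 0 (Real.pi / 2),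
      ‖Real.sin θ * ∫ p : E × E, ⟪h' (f p.1) • g p.1,
          g (Real.cos θ • p.1 + Real.sin θ • p.2)⟫_ℝ ∂(γ).prod γ
        - (Real.sin θ * ∫ p : E × E, ⟪g p.1,
          g (Real.cos θ • p.1 + Real.sin θ • p.2)⟫_ℝ ∂(γ).prod γ) * ∫ x, h' (f x) ∂γ‖
      ≤ M * K * (Real.sin θ + Real.sin θ * Real.cos θ) := by
    intro θ hθ
    have hsin : 0 ≤ Real.sin θ :=
      Real.sin_nonneg_of_nonneg_of_le_pi hθ.1.le (by linarith [hθ.2, Real.pi_pos])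
    have hcos : 0 ≤ Real.cos θ :=
      Real.cos_nonneg_of_neg_pi_div_two_le_of_le (by linarith [hθ.1, Real.pi_pos]) hθ.2
    set W : E → E → ℝ := fun x y ↦ ⟪g x, g (Real.cos θ • x + Real.sin θ • y)⟫_ℝ with hW
    have hWc : Continuous (Function.uncurry W) := by
      simp only [hW, Function.uncurry_def]; fun_prop
    have hWb : ∀ x y, |W x y| ≤ Cg * Cg := fun x y ↦
      (abs_real_inner_le_norm _ _).trans (mul_le_mul (hCg _) (hCg _) (norm_nonneg _) hCg0)
    have hWx : ∀ x, Continuous (W x) := fun x ↦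
      hWc.comp (by fun_prop : Continuous fun y ↦ (x, y))
    have hadj : Continuous fun x ↦ ContinuousLinearMap.adjoint (A x) :=
      ContinuousLinearMap.adjoint.continuous.comp hA
    have hV := integral_sq_sub_integral_le (W := W)
      (gW := fun x y ↦ ContinuousLinearMap.adjoint (A x) (g (Real.cos θ • x + Real.sin θ • y)) +
        Real.cos θ • ContinuousLinearMap.adjoint (A (Real.cos θ • x + Real.sin θ • y)) (g x))
      (C := Cg * Cg) (D := CA * Cg + CA * Cg) (hasGradientAt_inner_mix hg _ _) hWc
      (by
        have h2 : Continuous fun p : E × E ↦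
            ContinuousLinearMap.adjoint (A (Real.cos θ • p.1 + Real.sin θ • p.2)) :=
          hadj.comp (by fun_prop : Continuous fun p : E × E ↦
            Real.cos θ • p.1 + Real.sin θ • p.2)
        simp only [Function.uncurry_def]
        exact ((hadj.comp continuous_fst).clm_apply (by fun_prop)).add
          ((h2.clm_apply (by fun_prop)).const_smul _)) hWb
      (fun x y ↦ by
        have hadj : ∀ z w : E, ‖ContinuousLinearMap.adjoint (A z) (g w)‖ ≤ CA * Cg := by
          intro z w
          refine (ContinuousLinearMap.le_opNorm _ _).trans ?_
          rw [LinearIsometryEquiv.norm_map]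
          exact mul_le_mul (hCA z) (hCg w) (norm_nonneg _) hCA0
        refine (norm_add_le _ _).trans (add_le_add (hadj _ _) ?_)
        rw [norm_smul]
        exact (mul_le_of_le_one_left (norm_nonneg _) (Real.abs_cos_le_one θ)).trans (hadj _ _))
    have hV' := hV.trans (integral_norm_gradient_inner_mix_sq_le hgc hA hCg hCA hK4 hcos)
    have hSc : Continuous fun x ↦ ∫ y, W x y ∂γ :=
      continuous_of_dominated (bound := fun _ ↦ Cg * Cg) (fun x ↦ (hWx x).aestronglyMeasurable)
        (fun x ↦ ae_of_all _ (hWb x)) (integrable_const _)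
        (ae_of_all _ fun y ↦ hWc.comp (by fun_prop : Continuous fun x ↦ (x, y)))
    have hSb : ∀ x, ‖∫ y, W x y ∂γ‖ ≤ Cg * Cg := fun x ↦ by
      simpa using norm_integral_le_of_norm_le_const (μ := γ) (f := W x) (ae_of_all _ (hWb x))
    have key := abs_integral_mul_sub_le (ν := γ) (ψ := fun x ↦ h' (f x))
      (S := fun x ↦ ∫ y, W x y ∂γ) (by fun_prop : Continuous _).aestronglyMeasurable
      (fun x ↦ hM _) (memLp_of_continuous_of_bound hSc hSb 2) (by positivity) hV'
    have hWi : Integrable (fun p : E × E ↦ W p.1 p.2) ((γ).prod γ) :=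
      integrable_of_continuous_of_bound hWc fun p ↦ hWb _ _
    have f1 : ∫ p : E × E, ⟪h' (f p.1) • g p.1,
          g (Real.cos θ • p.1 + Real.sin θ • p.2)⟫_ℝ ∂(γ).prod γ
        = ∫ x, h' (f x) * ∫ y, W x y ∂γ ∂γ := by
      have : ∀ p : E × E, ⟪h' (f p.1) • g p.1, g (Real.cos θ • p.1 + Real.sin θ • p.2)⟫_ℝ
          = h' (f p.1) * W p.1 p.2 := fun p ↦ by rw [real_inner_smul_left]
      simp_rw [this]
      rw [integral_prod]
      · simp_rw [integral_const_mul]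
      · exact hWi.bdd_mul (Continuous.aestronglyMeasurable (by fun_prop))
          (ae_of_all _ fun p ↦ hM (f p.1))
    have f2 : ∫ p : E × E, ⟪g p.1, g (Real.cos θ • p.1 + Real.sin θ • p.2)⟫_ℝ ∂(γ).prod γ
        = ∫ x, ∫ y, W x y ∂γ ∂γ := integral_prod _ hWi
    rw [f1, f2, mul_assoc, ← mul_sub, norm_mul, Real.norm_of_nonneg hsin, Real.norm_eq_abs,
      mul_comm (∫ x, ∫ y, W x y ∂γ ∂γ)]
    calc _ ≤ Real.sin θ * (M * ((1 + Real.cos θ) * K)) :=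
          mul_le_mul_of_nonneg_left key hsin
      _ = _ := by ring
  have hfin := intervalIntegral.norm_integral_le_of_norm_le (μ := volume)
    (a := 0) (b := Real.pi / 2) (by positivity) (ae_of_all _ hbound)
    ((by fun_prop : Continuous fun θ ↦ M * K * (Real.sin θ + Real.sin θ * Real.cos θ)
      ).intervalIntegrable _ _)
  refine hfin.trans_eq ?_
  -- The constant 3/2 is ∫ sin θ + ∫ sin θ cos θ = 1 + 1/2 on [0, π/2].
  rw [intervalIntegral.integral_const_mul, intervalIntegral.integral_add
    (Real.continuous_sin.intervalIntegrable _ _)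
    ((by fun_prop : Continuous fun x ↦ Real.sin x * Real.cos x).intervalIntegrable _ _),
    integral_sin, integral_sin_mul_cos₁]
  simp
  ring

end Finite

/-! ### From a Stein error to a distance from the Gaussian law. -/

/-- `ρ` satisfies the Stein identity of `𝒩(m, s²)` up to an error `κ` times the Lipschitz constant
of the test function. -/
def HasSteinDiscrepancyLE (ρ : Measure ℝ) (m s κ : ℝ) : Prop :=
  ∀ (h h' : ℝ → ℝ) (M : ℝ), (∀ z, HasDerivAt h (h' z) z) → Continuous h' → (∀ z, |h' z| ≤ M) →
    |∫ x, h x * (x - m) ∂ρ - s ^ 2 * ∫ x, h' x ∂ρ| ≤ M * κ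

lemma map_affine_gaussianReal (m s : ℝ) :
    (gaussianReal 0 1).map (fun y ↦ m + s * y) = gaussianReal m (s ^ 2).toNNReal := by
  have h1 := gaussianReal_map_const_mul (μ := 0) (v := 1) s
  have h2 := gaussianReal_map_const_add (μ := s * 0) (v := .mk (s ^ 2) (sq_nonneg _) * 1) m
  rw [← h1, Measure.map_map (by fun_prop) (by fun_prop)] at h2
  rw [show (fun y ↦ m + s * y) = (m + ·) ∘ (s * ·) from rfl, h2]
  congr 1
  · ring
  · rw [mul_one]
    ext
    simp [sq_nonneg]

lemma integral_gaussianReal_affine (m s : ℝ) {φ : ℝ → ℝ} (hφ : Continuous φ) :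
    ∫ x, φ x ∂gaussianReal m (s ^ 2).toNNReal = ∫ y, φ (m + s * y) ∂gaussianReal 0 1 := by
  rw [← map_affine_gaussianReal, integral_map (by fun_prop) hφ.aestronglyMeasurable]

section SteinEquation

lemma hasDerivAt_exp_neg_sq (u : ℝ) :
    HasDerivAt (fun u : ℝ ↦ Real.exp (-u ^ 2 / 2)) (-u * Real.exp (-u ^ 2 / 2)) u := by
  have h1 : HasDerivAt (fun u : ℝ ↦ -u ^ 2 / 2) (-u) u := by
    refine ((hasDerivAt_pow 2 u).neg.div_const 2).congr_deriv ?_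
    simp; ring
  exact h1.exp.congr_deriv (by ring)

lemma integrable_exp_neg_sq_div_two : Integrable fun u : ℝ ↦ Real.exp (-u ^ 2 / 2) := by
  have := integrable_exp_neg_mul_sq (b := 1 / 2) (by norm_num)
  refine this.congr (ae_of_all _ fun u ↦ ?_)
  dsimp only; congr 1; ring

lemma integrable_mul_exp_neg_sq_div_two :
    Integrable fun u : ℝ ↦ -u * Real.exp (-u ^ 2 / 2) := by
  have := (integrable_mul_exp_neg_mul_sq (b := 1 / 2) (by norm_num)).neg
  refine this.congr (ae_of_all _ fun u ↦ ?_)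
  simp only [Pi.neg_apply, neg_mul, neg_inj]
  congr 2; ring

lemma tendsto_exp_neg_sq_div_two_atTop :
    Tendsto (fun u : ℝ ↦ Real.exp (-u ^ 2 / 2)) atTop (𝓝 0) := by
  refine Real.tendsto_exp_atBot.comp ?_
  have : Tendsto (fun u : ℝ ↦ u ^ 2) atTop atTop := tendsto_pow_atTop two_ne_zero
  refine (tendsto_neg_atTop_atBot.comp (this.atTop_div_const zero_lt_two)).congr fun u ↦ ?_
  simp [neg_div]

lemma tendsto_exp_neg_sq_div_two_atBot :
    Tendsto (fun u : ℝ ↦ Real.exp (-u ^ 2 / 2)) atBot (𝓝 0) := by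
  have := tendsto_exp_neg_sq_div_two_atTop.comp tendsto_neg_atBot_atTop
  simpa [Function.comp_def] using this

/-- A solution of the Stein equation `f' - x f = ψ`, for `|ψ| ≤ 1` with zero Gaussian mean, whose
derivative is bounded by `2`. -/
lemma exists_stein_solution {ψ : ℝ → ℝ} (hψ : Continuous ψ) (hb : ∀ x, |ψ x| ≤ 1)
    (h0 : ∫ x, ψ x * Real.exp (-x ^ 2 / 2) = 0) :
    ∃ f : ℝ → ℝ, (∀ x, HasDerivAt f (x * f x + ψ x) x) ∧ ∀ x, |x * f x + ψ x| ≤ 2 := by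
  set e : ℝ → ℝ := fun u ↦ Real.exp (-u ^ 2 / 2) with he
  have hec : Continuous e := by fun_prop
  have hepos : ∀ u, 0 < e u := fun u ↦ Real.exp_pos _
  have hint : Integrable (fun x ↦ ψ x * e x) :=
    integrable_exp_neg_sq_div_two.bdd_mul hψ.aestronglyMeasurable (ae_of_all _ hb)
  set I : ℝ → ℝ := fun x ↦ ∫ u in Set.Iic x, ψ u * e u with hI
  have hId : ∀ x, HasDerivAt I (ψ x * e x) x := by
    intro x
    have e1 : I = fun x ↦ I 0 + ∫ u in (0 : ℝ)..x, ψ u * e u := by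
      ext x
      have := intervalIntegral.integral_Iic_sub_Iic (a := 0) (b := x) hint.integrableOn
        hint.integrableOn
      rw [← this]; simp only [hI]; ring
    rw [e1]
    refine (intervalIntegral.integral_hasDerivAt_right (hint.intervalIntegrable)
      (Continuous.stronglyMeasurableAtFilter (by fun_prop) _ _)
      (Continuous.continuousAt (by fun_prop))).const_add _
  -- The vanishing mean lets I be computed on either tail, so that the tail on the side of x can
  -- always be used.
  have hIneg : ∀ x, I x = -∫ u in Set.Ioi x, ψ u * e u := by
    intro x
    have := intervalIntegral.integral_Iic_add_Ioi (b := x) hint.integrableOn hint.integrableOn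
    rw [h0] at this
    simp only [hI]; linarith
  have habs : ∀ S : Set ℝ, MeasurableSet S → ∀ c : ℝ, (∀ u ∈ S, 0 ≤ c → c * e u ≤ |u| * e u) →
      0 ≤ c → c * |∫ u in S, ψ u * e u| ≤ ∫ u in S, |u| * e u := by
    intro S hS c hc hc0
    have hi : Integrable (fun u ↦ |u| * e u) := by
      refine integrable_mul_exp_neg_sq_div_two.norm.congr (ae_of_all _ fun u ↦ ?_)
      simp [he]
    calc c * |∫ u in S, ψ u * e u| ≤ c * ∫ u in S, |ψ u * e u| :=
          mul_le_mul_of_nonneg_left (abs_integral_le_integral_abs) hc0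
      _ = ∫ u in S, c * |ψ u * e u| := (integral_const_mul _ _).symm
      _ ≤ ∫ u in S, |u| * e u := by
          refine setIntegral_mono_on (hint.abs.const_mul c).integrableOn hi.integrableOn hS
            fun u hu ↦ (le_trans ?_ (hc u hu hc0))
          rw [abs_mul, abs_of_pos (hepos u)]
          exact mul_le_mul_of_nonneg_left (mul_le_of_le_one_left (hepos u).le (hb u)) hc0
  -- On the tail beyond x one has |x| ≤ |u|, and |u| exp(−u²/2) integrates there to exactly
  -- exp(−x²/2).
  have hxI : ∀ x, |x| * |I x| ≤ e x := by
    intro x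
    rcases le_total x 0 with hx | hx
    · have h1 := habs (Set.Iic x) measurableSet_Iic |x| (fun u hu _ ↦
        mul_le_mul_of_nonneg_right (by
          rw [abs_of_nonpos hx, abs_of_nonpos (le_trans hu hx)]; exact neg_le_neg hu)
          (hepos u).le) (abs_nonneg x)
      refine h1.trans_eq ?_
      have h2 := integral_Iic_of_hasDerivAt_of_tendsto' (a := x) (f := e)
        (fun u _ ↦ hasDerivAt_exp_neg_sq u) integrable_mul_exp_neg_sq_div_two.integrableOn
        tendsto_exp_neg_sq_div_two_atBot
      rw [sub_zero] at h2
      rw [← h2]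
      refine setIntegral_congr_fun measurableSet_Iic fun u hu ↦ ?_
      simp only [abs_of_nonpos (le_trans hu hx), he]
    · have h1 := habs (Set.Ioi x) measurableSet_Ioi |x| (fun u hu _ ↦
        mul_le_mul_of_nonneg_right (by
          rw [abs_of_nonneg hx, abs_of_nonneg (hx.trans (le_of_lt hu))]; exact le_of_lt hu)
          (hepos u).le) (abs_nonneg x)
      rw [hIneg, abs_neg]
      refine h1.trans_eq ?_
      have h2 := integral_Ioi_of_hasDerivAt_of_tendsto' (a := x) (f := e)
        (fun u _ ↦ hasDerivAt_exp_neg_sq u) integrable_mul_exp_neg_sq_div_two.integrableOn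
        tendsto_exp_neg_sq_div_two_atTop
      have h3 : ∫ u in Set.Ioi x, |u| * e u = -∫ u in Set.Ioi x, -u * Real.exp (-u ^ 2 / 2) := by
        rw [← integral_neg]
        refine setIntegral_congr_fun measurableSet_Ioi fun u hu ↦ ?_
        simp only [abs_of_nonneg (hx.trans (le_of_lt hu)), he]; ring
      rw [h3, h2]; ring
  refine ⟨fun x ↦ I x / e x, fun x ↦ ?_, fun x ↦ ?_⟩
  · refine ((hId x).div (hasDerivAt_exp_neg_sq x) (hepos x).ne').congr_deriv ?_
    have := (hepos x).ne'
    change (ψ x * e x * e x - I x * (-x * e x)) / e x ^ 2 = _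
    field_simp
    ring
  · have h1 : |x * (I x / e x)| ≤ 1 := by
      rw [abs_mul, abs_div, abs_of_pos (hepos x), ← mul_div_assoc, div_le_one (hepos x)]
      exact hxI x
    exact (abs_add_le _ _).trans (by linarith [hb x])

end SteinEquation

/-- The Stein solution for the standardized, centred test function is used as h. It has slope at
most 2/s, and the Stein equation turns the Stein error into −s times the difference of the two
means. -/
lemma abs_integral_sub_gaussianReal_le_of_continuous {ρ : Measure ℝ} [IsProbabilityMeasure ρ]
    {m s κ : ℝ} (hs : 0 < s) (hρ : HasSteinDiscrepancyLE ρ m s κ)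
    (hρ2 : MemLp id 2 ρ) {φ : ℝ → ℝ} (hφ : Continuous φ) (h0 : ∀ x, 0 ≤ φ x) (h1 : ∀ x, φ x ≤ 1) :
    |∫ x, φ x ∂ρ - ∫ x, φ x ∂gaussianReal m (s ^ 2).toNNReal| ≤ 2 * κ / s ^ 2 := by
  set c := ∫ x, φ x ∂gaussianReal m (s ^ 2).toNNReal with hc
  have hφb : ∀ x, |φ x| ≤ 1 := fun x ↦ by rw [abs_of_nonneg (h0 x)]; exact h1 x
  have hc0 : 0 ≤ c := integral_nonneg h0
  have hc1 : c ≤ 1 := by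
    have := integral_mono (μ := gaussianReal m (s ^ 2).toNNReal)
      (integrable_of_continuous_of_bound hφ hφb) (integrable_const 1) h1
    simpa using this
  set ψ : ℝ → ℝ := fun z ↦ φ (m + s * z) - c with hψ
  have hψc : Continuous ψ := by fun_prop
  have hψb : ∀ z, |ψ z| ≤ 1 := fun z ↦ abs_le.2
    ⟨by linarith [h0 (m + s * z)], by linarith [h1 (m + s * z)]⟩
  have hψ0 : ∫ z, ψ z ∂gaussianReal 0 1 = 0 := by
    simp only [hψ]
    rw [integral_sub (integrable_of_continuous_of_bound (by fun_prop) fun z ↦ hφb _)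
      (integrable_const _), ← integral_gaussianReal_affine m s hφ]
    simp [hc]
  have hψ0' : ∫ z, ψ z * Real.exp (-z ^ 2 / 2) = 0 := by
    rw [integral_gaussianReal_eq_integral_smul one_ne_zero, gaussianPDFReal_def] at hψ0
    simp only [smul_eq_mul, mul_assoc] at hψ0
    rw [integral_const_mul] at hψ0
    have hne : (√(2 * (Real.pi * ((1 : ℝ≥0) : ℝ))))⁻¹ ≠ 0 := by
      have := Real.pi_pos
      simp; positivity
    rw [← (mul_eq_zero.1 hψ0).resolve_left hne]
    congr 1; ext z
    simp [mul_comm]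
  obtain ⟨f, hf, hfb⟩ := exists_stein_solution hψc hψb hψ0'
  have hfc : Continuous f := continuous_iff_continuousAt.2 fun t ↦ (hf t).continuousAt
  have hsne := hs.ne'
  have key := hρ (fun x ↦ f ((x - m) / s))
    (fun x ↦ ((x - m) / s * f ((x - m) / s) + ψ ((x - m) / s)) * s⁻¹) (2 * s⁻¹)
    (fun z ↦ by
      have h : HasDerivAt (fun x ↦ (x - m) / s) s⁻¹ z := by
        simpa using ((hasDerivAt_id z).sub_const m).div_const s
      exact (hf _).comp z h) (by fun_prop)
    (fun z ↦ by
      rw [abs_mul, abs_of_pos (inv_pos.2 hs)]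
      exact mul_le_mul_of_nonneg_right (hfb _) (inv_pos.2 hs).le)
  -- Linear growth of the solution, with a second moment of ρ, makes the product f((x − m)/s)(x − m)
  -- integrable.
  have hlin : ∀ x, |f x| ≤ |f 0| + 2 * |x| := by
    intro x
    have := Convex.norm_image_sub_le_of_norm_hasDerivWithin_le (f := f) (s := Set.univ)
      (fun y _ ↦ (hf y).hasDerivWithinAt) (fun y _ ↦ hfb y) convex_univ (Set.mem_univ 0)
      (Set.mem_univ x)
    rw [sub_zero, Real.norm_eq_abs, Real.norm_eq_abs] at this
    have h3 := abs_sub_abs_le_abs_sub (f x) (f 0)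
    linarith
  have hφi : Integrable φ ρ := integrable_of_continuous_of_bound hφ hφb
  have hzi : MemLp (fun x ↦ (x - m) / s) 2 ρ := by
    have := (hρ2.sub (memLp_const m)).const_mul s⁻¹
    refine this.ae_eq (ae_of_all _ fun x ↦ ?_)
    simp; ring
  have hfi : MemLp (fun x ↦ f ((x - m) / s)) 2 ρ := by
    refine MemLp.of_le ((memLp_const |f 0|).add (hzi.norm.const_mul 2))
      (Continuous.aestronglyMeasurable (by fun_prop)) (ae_of_all _ fun x ↦ ?_)
    refine (hlin _).trans (le_abs_self _)
  have hi1 : Integrable (fun x ↦ f ((x - m) / s) * (x - m)) ρ :=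
    hfi.integrable_mul (hρ2.sub (memLp_const m))
  have hi2 : Integrable
      (fun x ↦ ((x - m) / s * f ((x - m) / s) + ψ ((x - m) / s)) * s⁻¹) ρ :=
    integrable_of_continuous_of_bound (C := 2 * s⁻¹) (by fun_prop) fun z ↦ by
      rw [norm_mul, Real.norm_of_nonneg (inv_pos.2 hs).le]
      exact mul_le_mul_of_nonneg_right (hfb _) (inv_pos.2 hs).le
  rw [← integral_const_mul, ← integral_sub hi1 (hi2.const_mul _)] at key
  have e : ∀ x, f ((x - m) / s) * (x - m)
      - s ^ 2 * (((x - m) / s * f ((x - m) / s) + ψ ((x - m) / s)) * s⁻¹) = -s * (φ x - c) := by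
    intro x
    have : ψ ((x - m) / s) = φ x - c := by
      simp only [hψ]; congr 2; field_simp; ring
    rw [this]; field_simp; ring
  simp_rw [e] at key
  rw [integral_const_mul, integral_sub hφi (integrable_const _), abs_mul, abs_neg,
    abs_of_pos hs] at key
  simp only [integral_const, probReal_univ, one_smul] at key
  rw [le_div_iff₀ (by positivity)]
  calc _ = s * (s * |∫ x, φ x ∂ρ - c|) := by ring
    _ ≤ s * (2 * s⁻¹ * κ) := mul_le_mul_of_nonneg_left key hs.le
    _ = 2 * κ := by field_simp

/-- Along the path m + cos t (x − m) + s sin t y from ρ to the Gaussian, the derivative of the mean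
of φ is −sin t times a Stein error. Its test function `H t` averages φ' over y, so its slope is
bounded by the Lipschitz constant of φ alone; the bound on φ'' only justifies the calculus. -/
lemma abs_integral_sub_gaussianReal_le_of_lipschitz {ρ : Measure ℝ} [IsProbabilityMeasure ρ]
    {m s κ : ℝ} (hs : 0 < s) (hρ : HasSteinDiscrepancyLE ρ m s κ) (hρi : Integrable id ρ)
    {φ φ' φ'' : ℝ → ℝ} (hφ : ∀ x, HasDerivAt φ (φ' x) x) (hφ' : ∀ x, HasDerivAt φ' (φ'' x) x)
    (hφ'' : Continuous φ'') {C C'' : ℝ} (hC : ∀ x, |φ x| ≤ C) (h1 : ∀ x, |φ' x| ≤ 1)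
    (hC'' : ∀ x, |φ'' x| ≤ C'') :
    |∫ x, φ x ∂ρ - ∫ x, φ x ∂gaussianReal m (s ^ 2).toNNReal| ≤ κ / s := by
  have hφc : Continuous φ := continuous_iff_continuousAt.2 fun t ↦ (hφ t).continuousAt
  have hφ'c : Continuous φ' := continuous_iff_continuousAt.2 fun t ↦ (hφ' t).continuousAt
  have hC''0 : 0 ≤ C'' := (abs_nonneg _).trans (hC'' 0)
  set N := gaussianReal 0 1 with hN
  have hNi : Integrable (fun y : ℝ ↦ y) N := IsGaussian.integrable_id
  have hxi : Integrable (fun x : ℝ ↦ x - m) ρ := hρi.sub (integrable_const m)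
  set U : ℝ → ℝ × ℝ → ℝ := fun t q ↦ m + Real.cos t * (q.1 - m) + s * Real.sin t * q.2 with hU
  set Φ : ℝ → ℝ := fun t ↦ ∫ q, φ (U t q) ∂ρ.prod N with hΦ
  set H : ℝ → ℝ → ℝ := fun t x ↦ ∫ y, φ' (U t (x, y)) ∂N with hH
  set J : ℝ → ℝ → ℝ := fun t x ↦ ∫ y, φ'' (U t (x, y)) ∂N with hJ
  have hbi : Integrable (fun q : ℝ × ℝ ↦ |q.1 - m| + s * |q.2|) (ρ.prod N) :=
    (hxi.abs.comp_fst N).add ((hNi.abs.const_mul s).comp_snd ρ)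
  set Φ' : ℝ → ℝ × ℝ → ℝ := fun t q ↦
    φ' (U t q) * (-Real.sin t * (q.1 - m) + s * Real.cos t * q.2) with hΦ'
  have hΦ'b : ∀ t q, ‖Φ' t q‖ ≤ |q.1 - m| + s * |q.2| := by
    intro t q
    rw [hΦ', norm_mul]
    refine (mul_le_of_le_one_left (norm_nonneg _) (h1 _)).trans ((norm_add_le _ _).trans ?_)
    simp only [norm_mul, norm_neg, Real.norm_eq_abs, abs_of_pos hs]
    refine add_le_add (mul_le_of_le_one_left (abs_nonneg _) (Real.abs_sin_le_one t)) ?_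
    exact mul_le_mul_of_nonneg_right (mul_le_of_le_one_right hs.le (Real.abs_cos_le_one t))
      (abs_nonneg _)
  have hder : ∀ t, HasDerivAt Φ (∫ q, Φ' t q ∂ρ.prod N) t := fun t ↦
    (hasDerivAt_integral_of_dominated_loc_of_deriv_le (μ := ρ.prod N)
      (F := fun t q ↦ φ (U t q)) (F' := Φ') (x₀ := t) (s := Set.univ)
      (bound := fun q ↦ |q.1 - m| + s * |q.2|) univ_mem
      (Eventually.of_forall fun t ↦ Continuous.aestronglyMeasurable (by fun_prop))
      (integrable_of_continuous_of_bound (C := C) (by fun_prop) fun q ↦ hC _)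
      (Continuous.aestronglyMeasurable (by fun_prop)) (ae_of_all _ fun q t _ ↦ hΦ'b t q) hbi
      (ae_of_all _ fun q t _ ↦ by
        have h : HasDerivAt (fun t ↦ U t q) (-Real.sin t * (q.1 - m) + s * Real.cos t * q.2) t :=
          (((Real.hasDerivAt_cos t).mul_const _).const_add m).add
            (((Real.hasDerivAt_sin t).const_mul s).mul_const _)
        exact (hφ _).comp t h)).2
  have hHd : ∀ t x, HasDerivAt (H t) (Real.cos t * J t x) x := by
    intro t x
    have := (hasDerivAt_integral_of_dominated_loc_of_deriv_le (μ := N)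
      (F := fun x y ↦ φ' (U t (x, y))) (F' := fun x y ↦ Real.cos t * φ'' (U t (x, y))) (x₀ := x)
      (s := Set.univ) (bound := fun _ ↦ C'') univ_mem
      (Eventually.of_forall fun x ↦ Continuous.aestronglyMeasurable (by fun_prop))
      (integrable_of_continuous_of_bound (C := 1) (by fun_prop) fun q ↦ h1 _)
      (Continuous.aestronglyMeasurable (by fun_prop)) (ae_of_all _ fun y x _ ↦ by
        rw [norm_mul]
        exact (mul_le_of_le_one_left (norm_nonneg _) (Real.abs_cos_le_one t)).trans (hC'' _))
      (integrable_const _)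
      (ae_of_all _ fun y x _ ↦ by
        have h : HasDerivAt (fun x ↦ U t (x, y)) (Real.cos t) x := by
          exact (((((hasDerivAt_id x).sub_const m).const_mul (Real.cos t)).const_add m).add_const
            (s * Real.sin t * y)).congr_deriv (mul_one _)
        exact ((hφ' _).comp x h).congr_deriv (mul_comm _ _))).2
    rw [integral_const_mul] at this
    exact this
  have hJc : ∀ t, Continuous (J t) := fun t ↦
    continuous_of_dominated (bound := fun _ ↦ C'')
      (fun x ↦ Continuous.aestronglyMeasurable (by fun_prop)) (fun x ↦ ae_of_all _ fun y ↦ hC'' _)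
      (integrable_const _) (ae_of_all _ fun y ↦ by fun_prop)
  have hJb : ∀ t x, |J t x| ≤ C'' := fun t x ↦ by
    simpa using norm_integral_le_of_norm_le_const (μ := N) (f := fun y ↦ φ'' (U t (x, y)))
      (ae_of_all _ fun y ↦ hC'' _)
  -- Gaussian integration by parts in the second variable
  have hibp : ∀ t x, ∫ y, φ' (U t (x, y)) * y ∂N = s * Real.sin t * J t x := by
    intro t x
    have := integral_mul_id_gaussianReal (g := fun y ↦ φ' (U t (x, y)))
      (g' := fun y ↦ s * Real.sin t * φ'' (U t (x, y))) (C := 1) (C' := |s * Real.sin t| * C'')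
      (fun y ↦ by
        have h : HasDerivAt (fun y ↦ U t (x, y)) (s * Real.sin t) y := by
          exact (((hasDerivAt_id y).const_mul (s * Real.sin t)).const_add
            (m + Real.cos t * (x - m))).congr_deriv (mul_one _)
        exact ((hφ' _).comp y h).congr_deriv (mul_comm _ _)) (by fun_prop) (fun y ↦ h1 _)
      (fun y ↦ by
        rw [abs_mul]; exact mul_le_mul_of_nonneg_left (hC'' _) (abs_nonneg _))
    rw [integral_const_mul] at this
    exact this
  have hN1 : ∫ y, |y| ∂N ≤ 1 := by
    have h2 : MemLp (fun y : ℝ ↦ |y|) 2 N := (IsGaussian.memLp_two_id (μ := N)).norm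
    have h3 := sq_integral_le h2
    have h4 : ∫ y, |y| ^ 2 ∂N = 1 := by
      have := variance_id_gaussianReal (μ := 0) (v := 1)
      rw [variance_eq_sub (IsGaussian.memLp_two_id)] at this
      simpa using this
    rw [h4] at h3
    exact abs_le_of_sq_le_sq' (by simpa using h3) zero_le_one |>.2
  -- Integration by parts trades φ'' for φ' times y, and E|y| ≤ 1.
  have hsJ : ∀ t x, |s * Real.sin t * J t x| ≤ 1 := by
    intro t x
    rw [← hibp]
    have hb : ∀ y, ‖φ' (U t (x, y)) * y‖ ≤ |y| := fun y ↦ by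
      rw [norm_mul]; exact mul_le_of_le_one_left (abs_nonneg _) (h1 _)
    exact (norm_integral_le_of_norm_le hNi.abs (ae_of_all _ hb)).trans hN1
  have hform : ∀ t, ∫ q, Φ' t q ∂ρ.prod N = -Real.sin t *
      (∫ x, H t x * (x - m) ∂ρ - s ^ 2 * ∫ x, Real.cos t * J t x ∂ρ) := by
    intro t
    have hi : Integrable (Φ' t) (ρ.prod N) :=
      hbi.mono' (Continuous.aestronglyMeasurable (by fun_prop)) (ae_of_all _ (hΦ'b t))
    rw [integral_prod _ hi]
    have e : ∀ x, ∫ y, Φ' t (x, y) ∂N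
        = -Real.sin t * (H t x * (x - m) - s ^ 2 * (Real.cos t * J t x)) := by
      intro x
      have e1 : ∀ y, Φ' t (x, y) = -Real.sin t * (x - m) * φ' (U t (x, y))
          + s * Real.cos t * (φ' (U t (x, y)) * y) := by intro y; simp only [hΦ']; ring
      simp_rw [e1]
      rw [integral_add, integral_const_mul, integral_const_mul, hibp]
      · simp only [hH]; ring
      · exact (integrable_of_continuous_of_bound (C := 1) (by fun_prop)
          fun y ↦ h1 (U t (x, y))).const_mul _
      · exact (hNi.bdd_mul (Continuous.aestronglyMeasurable (by fun_prop))
          (ae_of_all _ fun y ↦ h1 (U t (x, y)))).const_mul _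
    have hHc : Continuous (H t) := continuous_iff_continuousAt.2 fun x ↦ (hHd t x).continuousAt
    have hHb : ∀ x, ‖H t x‖ ≤ 1 := fun x ↦ by
      simpa using norm_integral_le_of_norm_le_const (μ := N) (f := fun y ↦ φ' (U t (x, y)))
        (ae_of_all _ fun y ↦ h1 _)
    simp_rw [e]
    rw [integral_const_mul, integral_sub
      (hxi.bdd_mul hHc.aestronglyMeasurable (ae_of_all _ hHb))
      (((integrable_of_continuous_of_bound (hJc t) (hJb t)).const_mul _).const_mul _),
      integral_const_mul]
  -- Testing with the identity forces κ ≥ 0. This settles t = 0, where the slope bound cos t / (s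
  -- sin t) degenerates.
  have hκ0 : 0 ≤ κ := by
    have := hρ (fun z ↦ z) (fun _ ↦ 1) 1 (fun z ↦ hasDerivAt_id z) continuous_const (by simp)
    linarith [abs_nonneg (∫ x, x * (x - m) ∂ρ - s ^ 2 * ∫ _, 1 ∂ρ)]
  have hbound : ∀ t ∈ Set.Ico 0 (Real.pi / 2),
      ‖∫ q, Φ' t q ∂ρ.prod N‖ ≤ Real.cos t * (κ / s) := by
    intro t ht
    have hcos : 0 ≤ Real.cos t :=
      Real.cos_nonneg_of_neg_pi_div_two_le_of_le (by linarith [ht.1, Real.pi_pos]) ht.2.le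
    rw [hform]
    rcases eq_or_lt_of_le ht.1 with h | h
    · rw [← h]; simp; positivity
    · have hsin : 0 < Real.sin t :=
        Real.sin_pos_of_pos_of_lt_pi h (by linarith [ht.2, Real.pi_pos])
      have := hρ (H t) (fun x ↦ Real.cos t * J t x) (Real.cos t / (s * Real.sin t)) (hHd t)
        (continuous_const.mul (hJc t)) (fun x ↦ by
          rw [abs_mul, abs_of_nonneg hcos, div_eq_mul_inv]
          refine mul_le_mul_of_nonneg_left ?_ hcos
          have h5 := hsJ t x
          rw [abs_mul, abs_of_pos (by positivity)] at h5
          rw [← one_div, le_div_iff₀ (by positivity)]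
          linarith)
      rw [norm_mul, norm_neg, Real.norm_of_nonneg hsin.le, Real.norm_eq_abs]
      refine (mul_le_mul_of_nonneg_left this hsin.le).trans_eq ?_
      field_simp
  -- The factor sin t cancels the singular slope, so the speed is at most cos t · κ/s, of integral
  -- κ/s.
  have hfin := image_norm_le_of_norm_deriv_right_le_deriv_boundary
    (f := fun t ↦ Φ t - Φ 0) (a := 0) (b := Real.pi / 2)
    (B := fun t ↦ Real.sin t * (κ / s)) (B' := fun t ↦ Real.cos t * (κ / s))
    (fun t _ ↦ ((hder t).sub_const _).continuousAt.continuousWithinAt)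
    (fun t _ ↦ ((hder t).sub_const _).hasDerivWithinAt) (by simp)
    (fun t ↦ (Real.hasDerivAt_sin t).mul_const _) hbound
    (Set.right_mem_Icc.2 (by positivity))
  have e0 : Φ 0 = ∫ x, φ x ∂ρ := by
    simp only [hΦ, hU]
    simp only [Real.cos_zero, Real.sin_zero, one_mul, mul_zero, zero_mul, add_zero,
      add_sub_cancel]
    rw [integral_fun_fst (fun x ↦ φ x)]; simp
  have e1 : Φ (Real.pi / 2) = ∫ x, φ x ∂gaussianReal m (s ^ 2).toNNReal := by
    simp only [hΦ, hU]
    simp only [Real.cos_pi_div_two, Real.sin_pi_div_two, zero_mul, mul_one, add_zero]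
    rw [integral_fun_snd (fun y ↦ φ (m + s * y)), integral_gaussianReal_affine m s hφc]
    simp [hN]
  rw [abs_sub_comm, ← e0, ← e1]
  simpa using hfin

/-! ### The Hilbert–Schmidt operator of a tensor. -/

section Contraction

variable {H : Type*} [NormedAddCommGroup H] [InnerProductSpace ℝ H]

lemma norm_tmulH (a b : H) : ‖tmulH a b‖ = ‖a‖ * ‖b‖ := by
  rw [tmulH, UniformSpace.Completion.norm_coe, TensorProduct.norm_tmul]

lemma inner_tmulH (a b c d : H) : ⟪tmulH a b, tmulH c d⟫_ℝ = ⟪a, c⟫_ℝ * ⟪b, d⟫_ℝ := by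
  rw [tmulH, tmulH, UniformSpace.Completion.inner_coe, TensorProduct.inner_tmul]

variable [CompleteSpace H]

lemma inner_contractOp (T : HTensor H) (f g : H) : ⟪contractOp T f, g⟫_ℝ = ⟪T, tmulH f g⟫_ℝ := by
  rw [contractOp, InnerProductSpace.continuousLinearMapOfBilin_apply]
  rfl

lemma contractOp_sub (T S : HTensor H) : contractOp (T - S) = contractOp T - contractOp S := by
  ext f
  refine ext_inner_right ℝ fun g ↦ ?_
  rw [sub_apply, inner_sub_left]
  simp only [inner_contractOp, inner_sub_left]

/-- Pairing T with f ⊗ Tf gives ‖Tf‖² ≤ ‖T‖ ‖f‖ ‖Tf‖. This domination lets L⁴ convergence of second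
derivatives carry over to operator norms. -/
lemma norm_contractOp_le (T : HTensor H) : ‖contractOp T‖ ≤ ‖T‖ := by
  refine ContinuousLinearMap.opNorm_le_bound _ (norm_nonneg _) fun f ↦ ?_
  have h : ‖contractOp T f‖ ^ 2 ≤ ‖T‖ * ‖f‖ * ‖contractOp T f‖ := by
    rw [← real_inner_self_eq_norm_sq, inner_contractOp]
    refine (real_inner_le_norm _ _).trans_eq ?_
    rw [norm_tmulH, mul_assoc]
  rcases eq_or_ne (‖contractOp T f‖) 0 with h0 | h0
  · rw [h0]; positivity
  · have : 0 < ‖contractOp T f‖ := lt_of_le_of_ne (norm_nonneg _) h0.symm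
    rw [pow_two] at h
    exact le_of_mul_le_mul_right h this

lemma continuous_contractOp : Continuous (contractOp : HTensor H → H →L[ℝ] H) := by
  have : LipschitzWith 1 (contractOp : HTensor H → H →L[ℝ] H) :=
    LipschitzWith.of_dist_le_mul fun T S ↦ by
      rw [dist_eq_norm, dist_eq_norm, ← contractOp_sub, NNReal.coe_one, one_mul]
      exact norm_contractOp_le _
  exact this.continuous

end Contraction

/-! ### Partial derivatives of smooth compactly supported functions. -/

section PartialDerivatives

variable {n : ℕ} {g : (Fin n → ℝ) → ℝ}

lemma contDiff_partialDeriv (hg : ContDiff ℝ ((⊤ : ℕ∞) : WithTop ℕ∞) g) (i : Fin n) :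
    ContDiff ℝ ((⊤ : ℕ∞) : WithTop ℕ∞) (partialDeriv i g) :=
  (hg.fderiv_right (m := ((⊤ : ℕ∞) : WithTop ℕ∞)) (by simp)).clm_apply contDiff_const

lemma hasCompactSupport_partialDeriv (hg : HasCompactSupport g) (i : Fin n) :
    HasCompactSupport (partialDeriv i g) :=
  hg.fderiv_apply (𝕜 := ℝ) _

lemma fderiv_eq_sum_partialDeriv (x w : Fin n → ℝ) :
    fderiv ℝ g x w = ∑ i, partialDeriv i g x * w i := by
  conv_lhs => rw [← Finset.univ_sum_single w]
  rw [map_sum]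
  refine Finset.sum_congr rfl fun i _ ↦ ?_
  have : Pi.single i (w i) = w i • (Pi.single i 1 : Fin n → ℝ) := by
    rw [← Pi.single_smul]; simp
  rw [this, map_smul, smul_eq_mul, mul_comm, partialDeriv]

end PartialDerivatives

/-! ### White noise on finite-dimensional subspaces. -/

section Isonormal

variable {H Ω : Type*} [NormedAddCommGroup H] [InnerProductSpace ℝ H]
  [MeasurableSpace Ω] {P : Measure Ω} {X : H → Ω → ℝ}

lemma IsIsonormal.memLp (hX : IsIsonormal X P) (h : H) : MemLp (X h) 2 P :=
  (hX.gaussian.hasGaussianLaw_eval h).memLp_two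

/-- Linearity is forced by the covariance: the difference of the two sides is orthogonal in L² to
every X(g), hence to itself. -/
lemma IsIsonormal.ae_eq_sum (hX : IsIsonormal X P) {ι : Type*} [Fintype ι] (c : ι → ℝ)
    (φ : ι → H) : X (∑ k, c k • φ k) =ᵐ[P] fun ω ↦ ∑ k, c k * X (φ k) ω := by
  set h := ∑ k, c k • φ k with hh
  set D : Ω → ℝ := fun ω ↦ X h ω - ∑ k, c k * X (φ k) ω with hD
  have hS : MemLp (fun ω ↦ ∑ k, c k * X (φ k) ω) 2 P :=
    memLp_finsetSum _ fun k _ ↦ (hX.memLp (φ k)).const_mul (c k)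
  have hDL : MemLp D 2 P := (hX.memLp h).sub hS
  have horth : ∀ g, ∫ ω, X g ω * D ω ∂P = 0 := by
    intro g
    have hi : ∀ k, Integrable (fun ω ↦ c k * (X g ω * X (φ k) ω)) P := fun k ↦
      ((hX.memLp g).integrable_mul (hX.memLp (φ k))).const_mul _
    have e : ∀ ω, X g ω * D ω = X g ω * X h ω - ∑ k, c k * (X g ω * X (φ k) ω) := by
      intro ω
      simp only [hD, mul_sub, Finset.mul_sum]
      congr 1
      exact Finset.sum_congr rfl fun k _ ↦ by ring
    simp_rw [e]
    have h1 : Integrable (fun ω ↦ X g ω * X h ω) P := (hX.memLp g).integrable_mul (hX.memLp h)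
    rw [integral_sub h1
      (integrable_finsetSum _ fun k _ ↦ hi k), integral_finsetSum _ fun k _ ↦ hi k,
      hX.covariance]
    simp_rw [integral_const_mul, hX.covariance]
    rw [hh, inner_sum]
    simp [inner_smul_right]
  have hDD : ∫ ω, D ω ^ 2 ∂P = 0 := by
    have hi : ∀ k, Integrable (fun ω ↦ c k * (X (φ k) ω * D ω)) P := fun k ↦
      ((hX.memLp (φ k)).integrable_mul hDL).const_mul _
    have e : ∀ ω, D ω ^ 2 = X h ω * D ω - ∑ k, c k * (X (φ k) ω * D ω) := by
      intro ω
      rw [pow_two]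
      conv_lhs => enter [1]; rw [hD]
      rw [sub_mul, Finset.sum_mul]
      simp only [mul_assoc]
    simp_rw [e]
    have h1 : Integrable (fun ω ↦ X h ω * D ω) P := (hX.memLp h).integrable_mul hDL
    rw [integral_sub h1 (integrable_finsetSum _ fun k _ ↦ hi k),
      integral_finsetSum _ fun k _ ↦ hi k]
    simp_rw [integral_const_mul, horth]
    simp
  rw [integral_eq_zero_iff_of_nonneg (fun ω ↦ sq_nonneg _) hDL.integrable_sq] at hDD
  filter_upwards [hDD] with ω hω
  have : D ω = 0 := by simpa using hω
  linarith

lemma IsIsonormal.map_eq_gaussianReal (hX : IsIsonormal X P) (h : H) :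
    P.map (X h) = gaussianReal 0 (‖h‖ ^ 2).toNNReal := by
  have := hX.gaussian.isProbabilityMeasure
  rw [(hX.gaussian.hasGaussianLaw_eval h).map_eq_gaussianReal, hX.centered,
    variance_eq_sub (hX.memLp h), hX.centered]
  congr 2
  have := hX.covariance h h
  rw [real_inner_self_eq_norm_sq] at this
  simp only [Pi.pow_apply, ← this]
  simp [pow_two]

variable {V : Submodule ℝ H} [FiniteDimensional ℝ V]

/-- The orthogonal projection to a finite-dimensional subspace of the white noise
attached to an isonormal process. -/
noncomputable def noiseOn (V : Submodule ℝ H) [FiniteDimensional ℝ V] (X : H → Ω → ℝ) (ω : Ω) : V :=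
  ∑ k, X (stdOrthonormalBasis ℝ V k) ω • stdOrthonormalBasis ℝ V k

lemma IsIsonormal.ae_inner_noiseOn (hX : IsIsonormal X P) (v : V) :
    ∀ᵐ ω ∂P, ⟪v, noiseOn V X ω⟫_ℝ = X v ω := by
  set b := stdOrthonormalBasis ℝ V with hb
  have h := hX.ae_eq_sum (fun k ↦ ⟪b k, v⟫_ℝ) (fun k ↦ (b k : H))
  have hv : ∑ k, ⟪b k, v⟫_ℝ • (b k : H) = v := by
    conv_rhs => rw [← b.sum_repr' v]
    simp
  rw [hv] at h
  filter_upwards [h] with ω hω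
  rw [hω, noiseOn, inner_sum]
  refine Finset.sum_congr rfl fun k _ ↦ ?_
  rw [real_inner_smul_right, real_inner_comm, mul_comm]

lemma IsIsonormal.aemeasurable_noiseOn (hX : IsIsonormal X P) [MeasurableSpace V] [BorelSpace V] :
    AEMeasurable (noiseOn V X) P := by
  unfold noiseOn
  exact Finset.aemeasurable_fun_sum _ fun k _ ↦ (hX.gaussian.aemeasurable _).smul_const _

/-- Pairing the noise with t gives X(t), a centred Gaussian of variance ‖t‖², so the characteristic
functions agree. -/
lemma IsIsonormal.map_noiseOn (hX : IsIsonormal X P) [MeasurableSpace V] [BorelSpace V] :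
    P.map (noiseOn V X) = stdGaussian V := by
  have := hX.gaussian.isProbabilityMeasure
  have hm := hX.aemeasurable_noiseOn (V := V)
  have := Measure.isProbabilityMeasure_map hm
  refine Measure.ext_of_charFun ?_
  ext t
  rw [charFun_stdGaussian, charFun_apply, integral_map hm (by fun_prop)]
  have h1 : ∫ ω, Complex.exp (⟪noiseOn V X ω, t⟫_ℝ * Complex.I) ∂P
      = ∫ ω, Complex.exp (⟪X t ω, (1 : ℝ)⟫_ℝ * Complex.I) ∂P := by
    refine integral_congr_ae ?_
    filter_upwards [hX.ae_inner_noiseOn t] with ω hω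
    rw [real_inner_comm, hω]; simp
  have h2 : charFun (P.map (X t)) 1 = ∫ ω, Complex.exp (⟪X t ω, (1 : ℝ)⟫_ℝ * Complex.I) ∂P := by
    rw [charFun_apply, integral_map (hX.gaussian.aemeasurable _) (by fun_prop)]
  rw [h1, ← h2, hX.map_eq_gaussianReal, charFun_gaussianReal]
  congr 1
  have : (((‖(t : H)‖ ^ 2).toNNReal : ℝ) : ℂ) = (‖t‖ : ℂ) ^ 2 := by
    rw [Real.coe_toNNReal _ (sq_nonneg _)]; push_cast; rfl
  rw [this]; push_cast; ring

end Isonormal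

/-! ### Stein's identity with an error term for cylindrical random variables. -/

lemma integral_norm_pow_four_le_of_eLpNorm_le {α E : Type*} [MeasurableSpace α] {ν : Measure α}
    [NormedAddCommGroup E] {f : α → E} (hf : MemLp f 4 ν) {a : ℝ} (ha : 0 ≤ a)
    (h : eLpNorm f 4 ν ≤ ENNReal.ofReal a) : ∫ x, ‖f x‖ ^ 4 ∂ν ≤ a ^ 4 := by
  have h4 : (∫ x, ‖f x‖ ^ 4 ∂ν) = (eLpNorm f 4 ν).toReal ^ 4 := by
    have h0 : 0 ≤ ∫ x, ‖f x‖ ^ 4 ∂ν := integral_nonneg fun x ↦ by positivity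
    rw [hf.eLpNorm_eq_integral_rpow_norm (by norm_num) (by norm_num)]
    have e : ∫ x, ‖f x‖ ^ (4 : ℝ≥0∞).toReal ∂ν = ∫ x, ‖f x‖ ^ 4 ∂ν := by
      congr 1; ext x
      norm_cast
    rw [e, ENNReal.toReal_ofReal (by positivity), ← Real.rpow_natCast, ← Real.rpow_mul h0]
    norm_num
  rw [h4]
  exact pow_le_pow_left₀ ENNReal.toReal_nonneg (ENNReal.toReal_le_of_le_ofReal ha h) 4

lemma Cylinder.inner_contractOp_D2 {H Ω : Type*} [NormedAddCommGroup H] [InnerProductSpace ℝ H]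
    [CompleteSpace H] {X : H → Ω → ℝ} (G : Cylinder H) (ω : Ω) (v w : H) :
    ⟪contractOp (G.D2 X ω) v, w⟫_ℝ = ∑ i, ∑ j,
      partialDeriv i (partialDeriv j G.g) (G.vec X ω) * (⟪G.φ i, v⟫_ℝ * ⟪G.φ j, w⟫_ℝ) := by
  rw [inner_contractOp, Cylinder.D2, sum_inner]
  refine Finset.sum_congr rfl fun i _ ↦ ?_
  rw [sum_inner]
  refine Finset.sum_congr rfl fun j _ ↦ ?_
  rw [real_inner_smul_left, inner_tmulH]

section

variable {H Ω : Type*} [NormedAddCommGroup H] [InnerProductSpace ℝ H] [CompleteSpace H]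
  [MeasurableSpace Ω] {P : Measure Ω} {X : H → Ω → ℝ}

/-- The quantitative Stein identity for a cylindrical random variable which is a function of
a standard Gaussian vector `Y`. -/
lemma Cylinder.stein_discrepancy_of_map_eq_stdGaussian (G : Cylinder H)
    {V : Type*} [NormedAddCommGroup V] [InnerProductSpace ℝ V] [FiniteDimensional ℝ V]
    [MeasurableSpace V] [BorelSpace V] (emb : V →ₗᵢ[ℝ] H) (ψ : Fin G.n → V)
    (hψ : ∀ i, emb (ψ i) = G.φ i) {Y : Ω → V} (hm : AEMeasurable Y P)
    (hPX : P.map Y = stdGaussian V) (hYX : ∀ i, ∀ᵐ ω ∂P, ⟪ψ i, Y ω⟫_ℝ = X (G.φ i) ω)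
    {a b : ℝ} (ha : 0 ≤ a)
    (hb : 0 ≤ b) (hD2 : eLpNorm (fun ω ↦ contractOp (G.D2 X ω)) 4 P ≤ ENNReal.ofReal a)
    (hD : eLpNorm (G.D X) 4 P ≤ ENNReal.ofReal b)
    {h h' : ℝ → ℝ} (hh : ∀ z, HasDerivAt h (h' z) z) (hh' : Continuous h') {M : ℝ}
    (hM : ∀ z, |h' z| ≤ M) :
    |∫ ω, h (G.val X ω) * (G.val X ω - ∫ η, G.val X η ∂P) ∂P
      - (∫ ω, (G.val X ω - ∫ η, G.val X η ∂P) ^ 2 ∂P) * ∫ ω, h' (G.val X ω) ∂P|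
      ≤ M * (3 / 2 * (a * b)) := by
  -- the function on `V` representing `G`
  let L : V →L[ℝ] (Fin G.n → ℝ) := ContinuousLinearMap.pi fun i ↦ innerSL ℝ (ψ i)
  have hLv : ∀ v i, L v i = ⟪ψ i, v⟫_ℝ := fun v i ↦ rfl
  let f : V → ℝ := fun v ↦ G.g (L v)
  let g : V → V := fun v ↦ ∑ j, partialDeriv j G.g (L v) • ψ j
  let A : V → V →L[ℝ] V := fun v ↦ ∑ j, ∑ i,
    partialDeriv i (partialDeriv j G.g) (L v) • (innerSL ℝ (ψ i)).smulRight (ψ j)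
  have hsm1 : ∀ j, ContDiff ℝ ((⊤ : ℕ∞) : WithTop ℕ∞) (partialDeriv j G.g) :=
    contDiff_partialDeriv G.smooth
  have hsm2 : ∀ i j, ContDiff ℝ ((⊤ : ℕ∞) : WithTop ℕ∞) (partialDeriv i (partialDeriv j G.g)) :=
    fun i j ↦ contDiff_partialDeriv (hsm1 j) i
  have hc1 : ∀ j, Continuous (partialDeriv j G.g) := fun j ↦ (hsm1 j).continuous
  have hc2 : ∀ i j, Continuous (partialDeriv i (partialDeriv j G.g)) :=
    fun i j ↦ (hsm2 i j).continuous
  have hgrad : ∀ {k : (Fin G.n → ℝ) → ℝ}, ContDiff ℝ ((⊤ : ℕ∞) : WithTop ℕ∞) k → ∀ v,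
      HasFDerivAt (fun v ↦ k (L v)) (∑ i, partialDeriv i k (L v) • innerSL ℝ (ψ i)) v := by
    intro k hk v
    have h1 := (hk.differentiable (by simp) (L v)).hasFDerivAt.comp v L.hasFDerivAt
    refine h1.congr_fderiv ?_
    ext w
    simp only [ContinuousLinearMap.comp_apply, fderiv_eq_sum_partialDeriv, hLv, sum_apply,
      smul_apply, innerSL_apply_apply, smul_eq_mul]
  have hf : ∀ v, HasGradientAt f (g v) v := by
    intro v
    rw [hasGradientAt_iff_hasFDerivAt]
    refine (hgrad G.smooth v).congr_fderiv ?_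
    ext w
    simp [g]
  have hg : ∀ v, HasFDerivAt g (A v) v := by
    intro v
    have := HasFDerivAt.fun_sum (u := Finset.univ) fun j (_ : j ∈ Finset.univ) ↦
      (hgrad (hsm1 j) v).smul_const (ψ j)
    refine this.congr_fderiv ?_
    ext w
    simp [A, Finset.sum_smul, smul_smul]
  have hA : Continuous A := by
    refine continuous_finsetSum _ fun j _ ↦ continuous_finsetSum _ fun i _ ↦ ?_
    exact ((hc2 i j).comp L.continuous).smul continuous_const
  have hgc : Continuous g := continuous_iff_continuousAt.2 fun v ↦ (hg v).continuousAt
  obtain ⟨Cf, hCf⟩ := G.smooth.continuous.bounded_above_of_compact_support G.compact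
  choose C1 hC1 using fun j ↦
    (hc1 j).bounded_above_of_compact_support (hasCompactSupport_partialDeriv G.compact j)
  choose C2 hC2 using fun i j ↦ (hc2 i j).bounded_above_of_compact_support
    (hasCompactSupport_partialDeriv (hasCompactSupport_partialDeriv G.compact j) i)
  have hCg : ∀ v, ‖g v‖ ≤ ∑ j, C1 j * ‖ψ j‖ := fun v ↦ by
    refine (norm_sum_le _ _).trans (Finset.sum_le_sum fun j _ ↦ ?_)
    rw [norm_smul]
    exact mul_le_mul_of_nonneg_right (hC1 j _) (norm_nonneg _)
  have hCA : ∀ v, ‖A v‖ ≤ ∑ j, ∑ i, C2 i j * ‖(innerSL ℝ (ψ i)).smulRight (ψ j)‖ := fun v ↦ by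
    refine norm_sum_le_of_le _ fun j _ ↦ norm_sum_le_of_le _ fun i _ ↦ ?_
    refine (norm_smul_le _ ((innerSL ℝ (ψ i)).smulRight (ψ j))).trans ?_
    exact mul_le_mul_of_nonneg_right (hC2 i j _) (norm_nonneg _)
  -- comparison with `G` and its Malliavin derivatives
  have hvec : ∀ᵐ ω ∂P, L (Y ω) = G.vec X ω := by
    filter_upwards [ae_all_iff.2 hYX] with ω hω
    ext i
    exact hω i
  have hfG : ∀ᵐ ω ∂P, f (Y ω) = G.val X ω := by
    filter_upwards [hvec] with ω hω
    simp only [f, hω, Cylinder.val]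
  have hgG : ∀ᵐ ω ∂P, ‖g (Y ω)‖ ≤ ‖G.D X ω‖ := by
    filter_upwards [hvec] with ω hω
    rw [← emb.norm_map]
    simp [g, hω, Cylinder.D, hψ]
  -- The embedding of V intertwines A with the operator of D²G, so A is its restriction to V and has
  -- no larger norm.
  have hAG : ∀ᵐ ω ∂P, ‖A (Y ω)‖ ≤ ‖contractOp (G.D2 X ω)‖ := by
    filter_upwards [hvec] with ω hω
    refine ContinuousLinearMap.opNorm_le_bound _ (norm_nonneg _) fun w ↦ ?_
    have : emb (A (Y ω) w) = contractOp (G.D2 X ω) (emb w) := by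
      refine ext_inner_right ℝ fun z ↦ ?_
      rw [Cylinder.inner_contractOp_D2, Finset.sum_comm]
      simp only [A, hω, sum_apply, smul_apply, ContinuousLinearMap.smulRight_apply,
        innerSL_apply_apply, map_sum, map_smul, sum_inner, real_inner_smul_left, hψ,
        ← emb.inner_map_map (ψ _) w]
    rw [← emb.norm_map, this]
    exact ((contractOp (G.D2 X ω)).le_opNorm _).trans_eq (by rw [emb.norm_map])
  have hA4 : ∫ v, ‖A v‖ ^ 4 ∂stdGaussian V ≤ a ^ 4 := by
    refine integral_norm_pow_four_le_of_eLpNorm_le (memLp_of_continuous_of_bound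
      (E := V →L[ℝ] V) (f := A) hA hCA 4) ha ?_
    rw [← hPX, eLpNorm_map_measure hA.aestronglyMeasurable hm]
    exact (eLpNorm_mono_ae hAG).trans hD2
  have hg4 : ∫ v, ‖g v‖ ^ 4 ∂stdGaussian V ≤ b ^ 4 := by
    refine integral_norm_pow_four_le_of_eLpNorm_le (memLp_of_continuous_of_bound hgc hCg 4) hb ?_
    rw [← hPX, eLpNorm_map_measure hgc.aestronglyMeasurable hm]
    exact (eLpNorm_mono_ae hgG).trans hD
  have key := stein_discrepancy_stdGaussian hf hg hA (Cf := Cf) (fun v ↦ hCf _) hCg hCA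
    (K := a * b) (by positivity) (by
      rw [mul_pow]
      exact mul_le_mul hA4 hg4 (integral_nonneg fun x ↦ by positivity) (by positivity)) hh hh' hM
  have hfc : Continuous f := continuous_of_hasGradientAt hf
  have hhc : Continuous h := continuous_iff_continuousAt.2 fun t ↦ (hh t).continuousAt
  have htr : ∀ k : ℝ → ℝ, Continuous k →
      ∫ v, k (f v) ∂stdGaussian V = ∫ ω, k (G.val X ω) ∂P := by
    intro k hk
    rw [← hPX, integral_map hm (by fun_prop : Continuous fun v ↦ k (f v)).aestronglyMeasurable]
    refine integral_congr_ae ?_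
    filter_upwards [hfG] with ω hω
    rw [hω]
  rw [htr (fun z ↦ z) continuous_id,
    htr (fun z ↦ h z * (z - ∫ η, G.val X η ∂P)) (by fun_prop),
    htr (fun z ↦ (z - ∫ η, G.val X η ∂P) ^ 2) (by fun_prop), htr h' hh'] at key
  exact key

/-- The quantitative Stein identity for cylindrical random variables. -/
lemma Cylinder.stein_discrepancy (hX : IsIsonormal X P) (G : Cylinder H) {a b : ℝ} (ha : 0 ≤ a)
    (hb : 0 ≤ b) (hD2 : eLpNorm (fun ω ↦ contractOp (G.D2 X ω)) 4 P ≤ ENNReal.ofReal a)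
    (hD : eLpNorm (G.D X) 4 P ≤ ENNReal.ofReal b)
    {h h' : ℝ → ℝ} (hh : ∀ z, HasDerivAt h (h' z) z) (hh' : Continuous h') {M : ℝ}
    (hM : ∀ z, |h' z| ≤ M) :
    |∫ ω, h (G.val X ω) * (G.val X ω - ∫ η, G.val X η ∂P) ∂P
      - (∫ ω, (G.val X ω - ∫ η, G.val X η ∂P) ^ 2 ∂P) * ∫ ω, h' (G.val X ω) ∂P|
      ≤ M * (3 / 2 * (a * b)) := by
  let mV : MeasurableSpace (Submodule.span ℝ (Set.range G.φ)) := borel _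
  have : BorelSpace (Submodule.span ℝ (Set.range G.φ)) := ⟨rfl⟩
  have : FiniteDimensional ℝ (Submodule.span ℝ (Set.range G.φ)) :=
    FiniteDimensional.span_of_finite ℝ (Set.finite_range _)
  exact G.stein_discrepancy_of_map_eq_stdGaussian
    (Submodule.span ℝ (Set.range G.φ)).subtypeₗᵢ
    (fun i ↦ ⟨G.φ i, Submodule.subset_span ⟨i, rfl⟩⟩) (fun i ↦ rfl) hX.aemeasurable_noiseOn
    hX.map_noiseOn (fun i ↦ hX.ae_inner_noiseOn _) ha hb hD2 hD hh hh' hM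

end

/-! ### Passage to the limit in 𝔻^{2,4}. -/

lemma tendsto_integral_mul_of_tendsto_eLpNorm {α : Type*} [MeasurableSpace α] {ν : Measure α}
    {u v : ℕ → α → ℝ} {u₀ v₀ : α → ℝ} (hu : ∀ k, MemLp (u k) 2 ν) (hv : ∀ k, MemLp (v k) 2 ν)
    (hu₀ : MemLp u₀ 2 ν) (hv₀ : MemLp v₀ 2 ν)
    (hut : Tendsto (fun k ↦ eLpNorm (u k - u₀) 2 ν) atTop (𝓝 0))
    (hvt : Tendsto (fun k ↦ eLpNorm (v k - v₀) 2 ν) atTop (𝓝 0)) :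
    Tendsto (fun k ↦ ∫ x, u k x * v k x ∂ν) atTop (𝓝 (∫ x, u₀ x * v₀ x ∂ν)) := by
  have hU := (Lp.tendsto_Lp_iff_tendsto_eLpNorm'' u hu u₀ hu₀).2 hut
  have hV := (Lp.tendsto_Lp_iff_tendsto_eLpNorm'' v hv v₀ hv₀).2 hvt
  have hUV := hU.inner (𝕜 := ℝ) hV
  have e : ∀ {a b : α → ℝ} (ha : MemLp a 2 ν) (hb : MemLp b 2 ν),
      inner ℝ (ha.toLp a) (hb.toLp b) = ∫ x, a x * b x ∂ν := by
    intro a b ha hb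
    rw [L2.inner_def]
    refine integral_congr_ae ?_
    filter_upwards [ha.coeFn_toLp, hb.coeFn_toLp] with x hxa hxb
    rw [hxa, hxb]
    simp [mul_comm]
  simpa only [e] using hUV

section

variable {H Ω : Type*} [NormedAddCommGroup H] [InnerProductSpace ℝ H]
  [MeasurableSpace Ω] {P : Measure Ω} {X : H → Ω → ℝ}

lemma Cylinder.aemeasurable_vec (hX : IsIsonormal X P) (G : Cylinder H) :
    AEMeasurable (G.vec X) P :=
  aemeasurable_pi_lambda _ fun _ ↦ hX.gaussian.aemeasurable _

lemma Cylinder.memLp_val [IsProbabilityMeasure P] (hX : IsIsonormal X P) (G : Cylinder H)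
    (p : ℝ≥0∞) : MemLp (G.val X) p P := by
  obtain ⟨C, hC⟩ := G.smooth.continuous.bounded_above_of_compact_support G.compact
  exact MemLp.of_bound (G.smooth.continuous.comp_aestronglyMeasurable
    (G.aemeasurable_vec hX).aestronglyMeasurable) C (ae_of_all _ fun ω ↦ hC _)

lemma Cylinder.aestronglyMeasurable_D (hX : IsIsonormal X P) (G : Cylinder H) :
    AEStronglyMeasurable (G.D X) P := by
  have hv := (G.aemeasurable_vec hX).aestronglyMeasurable
  refine Finset.aestronglyMeasurable_fun_sum _ fun i _ ↦ ?_
  exact (((contDiff_partialDeriv G.smooth i).continuous).comp_aestronglyMeasurable hv).smul_const _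

lemma Cylinder.aestronglyMeasurable_D2 (hX : IsIsonormal X P) (G : Cylinder H) :
    AEStronglyMeasurable (G.D2 X) P := by
  have hv := (G.aemeasurable_vec hX).aestronglyMeasurable
  refine Finset.aestronglyMeasurable_fun_sum _ fun i _ ↦
    Finset.aestronglyMeasurable_fun_sum _ fun j _ ↦ ?_
  exact ((contDiff_partialDeriv (contDiff_partialDeriv G.smooth j)
    i).continuous.comp_aestronglyMeasurable hv).smul_const _

variable [CompleteSpace H]

/-- The quantitative Stein identity on `𝔻^{2,4}`. -/
lemma IsMalliavin2.hasSteinDiscrepancyLE [IsProbabilityMeasure P] (hX : IsIsonormal X P)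
    {F : Ω → ℝ} {DF : Ω → H} {D2F : Ω → HTensor H} (hF : IsMalliavin2 X P 4 F DF D2F)
    {m s : ℝ} (hm : ∫ ω, F ω ∂P = m) (hs : variance F P = s ^ 2) :
    HasSteinDiscrepancyLE (P.map F) m s
      (3 / 2 * ((eLpNorm (fun ω ↦ contractOp (D2F ω)) 4 P).toReal * (eLpNorm DF 4 P).toReal)) := by
  intro h h' M hh hh' hM
  have hM0 : 0 ≤ M := (abs_nonneg _).trans (hM 0)
  have hhc : Continuous h := continuous_iff_continuousAt.2 fun t ↦ (hh t).continuousAt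
  have hlip : ∀ x y, |h x - h y| ≤ M * |x - y| := fun x y ↦
    Convex.norm_image_sub_le_of_norm_hasDerivWithin_le (f := h) (s := Set.univ)
      (fun y _ ↦ (hh y).hasDerivWithinAt) (fun y _ ↦ hM y) convex_univ (Set.mem_univ y)
      (Set.mem_univ x)
  set a := (eLpNorm (fun ω ↦ contractOp (D2F ω)) 4 P).toReal with ha
  set b := (eLpNorm DF 4 P).toReal with hb
  obtain ⟨G₀, hG₀, hDG₀, hD2G₀⟩ := hF.exists_seq
  -- a subsequence converging almost surely
  obtain ⟨ns, hns, hae⟩ := (tendstoInMeasure_of_tendsto_eLpNorm (p := 4) (by norm_num)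
    (fun k ↦ ((G₀ k).memLp_val hX 4).aestronglyMeasurable) hF.memLp.aestronglyMeasurable
    hG₀).exists_seq_tendsto_ae
  set G : ℕ → Cylinder H := fun k ↦ G₀ (ns k) with hG
  have hval := hG₀.comp hns.tendsto_atTop
  have hDG := hDG₀.comp hns.tendsto_atTop
  have hD2G := hD2G₀.comp hns.tendsto_atTop
  set u : ℕ → Ω → ℝ := fun k ↦ (G k).val X with hu
  have hF2 : MemLp F 2 P := hF.memLp.mono_exponent (by norm_num)
  have hu2 : ∀ k, MemLp (u k) 2 P := fun k ↦ (G k).memLp_val hX 2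
  have hut : Tendsto (fun k ↦ eLpNorm (u k - F) 2 P) atTop (𝓝 0) := by
    refine tendsto_of_tendsto_of_tendsto_of_le_of_le tendsto_const_nhds hval (fun _ ↦ zero_le)
      fun k ↦ ?_
    exact eLpNorm_le_eLpNorm_of_exponent_le (by norm_num)
      ((hu2 k).aestronglyMeasurable.sub hF2.aestronglyMeasurable)
  have hone : MemLp (fun _ : Ω ↦ (1 : ℝ)) 2 P := memLp_const 1
  have hmean : Tendsto (fun k ↦ ∫ ω, u k ω ∂P) atTop (𝓝 m) := by
    have := tendsto_integral_mul_of_tendsto_eLpNorm hu2 (fun _ ↦ hone) hF2 hone hut (by simp)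
    simpa [hm] using this
  -- `L²` convergence of the centred variables and of their images under `h`
  set v : ℕ → Ω → ℝ := fun k ω ↦ u k ω - ∫ η, u k η ∂P with hv
  have hv2 : ∀ k, MemLp (v k) 2 P := fun k ↦ (hu2 k).sub (memLp_const _)
  have hv₀ : MemLp (fun ω ↦ F ω - m) 2 P := hF2.sub (memLp_const _)
  have hvt : Tendsto (fun k ↦ eLpNorm (v k - fun ω ↦ F ω - m) 2 P) atTop (𝓝 0) := by
    have hc : Tendsto (fun k ↦ ENNReal.ofReal |∫ η, u k η ∂P - m|) atTop (𝓝 0) := by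
      have := (hmean.sub_const m).abs
      rw [sub_self, abs_zero] at this
      simpa using ENNReal.tendsto_ofReal this
    have := hut.add hc
    rw [add_zero] at this
    refine tendsto_of_tendsto_of_tendsto_of_le_of_le tendsto_const_nhds this (fun _ ↦ zero_le)
      fun k ↦ ?_
    have e : (v k - fun ω ↦ F ω - m) = (u k - F) - fun _ ↦ (∫ η, u k η ∂P - m) := by
      ext ω; simp only [hv, Pi.sub_apply]; ring
    rw [e]
    refine (eLpNorm_sub_le ((hu2 k).sub hF2).aestronglyMeasurable
      aestronglyMeasurable_const (by norm_num)).trans (add_le_add le_rfl ?_)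
    rw [eLpNorm_const' _ (by norm_num) (by norm_num)]
    simp [Real.enorm_eq_ofReal_abs]
  have hhL : ∀ {w : Ω → ℝ}, MemLp w 2 P → MemLp (fun ω ↦ h (w ω)) 2 P := by
    intro w hw
    refine MemLp.of_le ((memLp_const |h 0|).add (hw.norm.const_mul M))
      (hhc.comp_aestronglyMeasurable hw.aestronglyMeasurable) (ae_of_all _ fun ω ↦ ?_)
    have h1 := hlip (w ω) 0
    rw [sub_zero] at h1
    have h2 := abs_sub_abs_le_abs_sub (h (w ω)) (h 0)
    refine le_trans ?_ (le_abs_self _)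
    simp only [Pi.add_apply, Real.norm_eq_abs]
    linarith
  have hht : Tendsto (fun k ↦ eLpNorm ((fun ω ↦ h (u k ω)) - fun ω ↦ h (F ω)) 2 P) atTop
      (𝓝 0) := by
    have : Tendsto (fun k ↦ ENNReal.ofReal M * eLpNorm (u k - F) 2 P) atTop (𝓝 0) := by
      simpa using ENNReal.Tendsto.const_mul hut (Or.inr ENNReal.ofReal_ne_top)
    refine tendsto_of_tendsto_of_tendsto_of_le_of_le tendsto_const_nhds this (fun _ ↦ zero_le)
      fun k ↦ ?_
    exact eLpNorm_le_mul_eLpNorm_of_ae_le_mul (ae_of_all _ fun ω ↦ hlip _ _) 2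
  have hL1 := tendsto_integral_mul_of_tendsto_eLpNorm (fun k ↦ hhL (hu2 k)) hv2 (hhL hF2) hv₀
    hht hvt
  have hL2 := tendsto_integral_mul_of_tendsto_eLpNorm hv2 hv2 hv₀ hv₀ hvt hvt
  -- Here h' is bounded and continuous but not Lipschitz, so L² convergence is not enough; almost
  -- sure convergence along the subsequence and domination are used.
  have hL3 : Tendsto (fun k ↦ ∫ ω, h' (u k ω) ∂P) atTop (𝓝 (∫ ω, h' (F ω) ∂P)) := by
    refine tendsto_integral_of_dominated_convergence (fun _ ↦ M)
      (fun k ↦ hh'.comp_aestronglyMeasurable (hu2 k).aestronglyMeasurable) (integrable_const _)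
      (fun k ↦ ae_of_all _ fun ω ↦ hM _) ?_
    filter_upwards [hae] with ω hω
    exact (hh'.tendsto _).comp hω
  have hvar : ∫ ω, (F ω - m) * (F ω - m) ∂P = s ^ 2 := by
    rw [← hs, variance_eq_integral hF2.aestronglyMeasurable.aemeasurable, hm]
    simp_rw [pow_two]
  rw [hvar] at hL2
  have hLHS := (hL1.sub (hL2.mul hL3)).abs
  have hmap : ∀ k : ℝ → ℝ, Continuous k → ∫ x, k x ∂P.map F = ∫ ω, k (F ω) ∂P := fun k hk ↦
    integral_map hF2.aestronglyMeasurable.aemeasurable hk.aestronglyMeasurable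
  rw [hmap (fun x ↦ h x * (x - m)) (by fun_prop), hmap h' hh']
  -- the norms of the derivatives
  have hD2F : AEStronglyMeasurable (fun ω ↦ contractOp (D2F ω)) P :=
    continuous_contractOp.comp_aestronglyMeasurable hF.memLp_D2.aestronglyMeasurable
  have hafin : eLpNorm (fun ω ↦ contractOp (D2F ω)) 4 P ≠ ∞ :=
    ((eLpNorm_mono fun ω ↦ norm_contractOp_le (D2F ω)).trans_lt hF.memLp_D2.eLpNorm_lt_top).ne
  have hbfin : eLpNorm DF 4 P ≠ ∞ := hF.memLp_D.eLpNorm_ne_top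
  have ha0 : 0 ≤ a := ENNReal.toReal_nonneg
  have hb0 : 0 ≤ b := ENNReal.toReal_nonneg
  -- For k large the norms of both derivatives are within ε of their limits; ε is sent to 0
  -- afterwards.
  have hε : ∀ ε : ℝ, 0 < ε → |∫ ω, h (F ω) * (F ω - m) ∂P - s ^ 2 * ∫ ω, h' (F ω) ∂P|
      ≤ M * (3 / 2 * ((a + ε) * (b + ε))) := by
    intro ε hε
    refine le_of_tendsto hLHS ?_
    have hε' : (0 : ℝ≥0∞) < ENNReal.ofReal ε := ENNReal.ofReal_pos.2 hε
    filter_upwards [hDG.eventually_le_const hε', hD2G.eventually_le_const hε'] with k h1 h2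
    have hbk : eLpNorm ((G k).D X) 4 P ≤ ENNReal.ofReal (b + ε) := by
      have e : (G k).D X = (fun ω ↦ (G k).D X ω - DF ω) + DF := by ext ω; simp
      rw [e, add_comm b, ENNReal.ofReal_add hε.le hb0, hb, ENNReal.ofReal_toReal hbfin]
      exact (eLpNorm_add_le (((G k).aestronglyMeasurable_D hX).sub
        hF.memLp_D.aestronglyMeasurable) hF.memLp_D.aestronglyMeasurable (by norm_num)).trans
        (add_le_add h1 le_rfl)
    have hak : eLpNorm (fun ω ↦ contractOp ((G k).D2 X ω)) 4 P ≤ ENNReal.ofReal (a + ε) := by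
      have e : (fun ω ↦ contractOp ((G k).D2 X ω))
          = (fun ω ↦ contractOp ((G k).D2 X ω - D2F ω)) + fun ω ↦ contractOp (D2F ω) := by
        ext ω : 1; simp [contractOp_sub]
      rw [e, add_comm a, ENNReal.ofReal_add hε.le ha0, ha, ENNReal.ofReal_toReal hafin]
      exact (eLpNorm_add_le (continuous_contractOp.comp_aestronglyMeasurable
        (((G k).aestronglyMeasurable_D2 hX).sub hF.memLp_D2.aestronglyMeasurable)) hD2F
        (by norm_num)).trans
        (add_le_add ((eLpNorm_mono fun ω ↦ norm_contractOp_le _).trans h2) le_rfl)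
    have := (G k).stein_discrepancy hX (by positivity) (by positivity) hak hbk hh hh' hM
    simpa only [pow_two] using this
  have hlim : Tendsto (fun ε : ℝ ↦ M * (3 / 2 * ((a + ε) * (b + ε)))) (𝓝[>] 0)
      (𝓝 (M * (3 / 2 * (a * b)))) := by
    have : Continuous fun ε : ℝ ↦ M * (3 / 2 * ((a + ε) * (b + ε))) := by fun_prop
    simpa using (this.tendsto 0).mono_left nhdsWithin_le_nhds
  exact ge_of_tendsto hlim (eventually_nhdsWithin_of_forall fun ε hε' ↦ hε ε hε')

end

/-! ### Extension to all Lipschitz functions and all Borel sets. -/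

lemma exists_smooth_lipschitz_approx {f : ℝ → ℝ} (hf : LipschitzWith 1 f)
    (hfs : HasCompactSupport f) {ε : ℝ} (hε : 0 < ε) :
    ∃ φ : ℝ → ℝ, ContDiff ℝ ((⊤ : ℕ∞) : WithTop ℕ∞) φ ∧ HasCompactSupport φ ∧ LipschitzWith 1 φ ∧
      ∀ x, |φ x - f x| ≤ ε := by
  -- Mollification at scale ε: an average of translates of f is still 1-Lipschitz and moves values
  -- by at most ε.
  let ρ : ContDiffBump (0 : ℝ) := ⟨ε / 2, ε, by positivity, by linarith⟩
  have hρs : HasCompactSupport (ρ.normed volume) := ρ.hasCompactSupport_normed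
  have hρc : Continuous (ρ.normed volume) := ρ.continuous_normed
  set φ := convolution (ρ.normed volume) f (ContinuousLinearMap.lsmul ℝ ℝ) volume with hφ
  have hex : ConvolutionExists (ρ.normed volume) f (ContinuousLinearMap.lsmul ℝ ℝ) volume :=
    hρs.convolutionExists_left _ hρc hf.continuous.locallyIntegrable
  refine ⟨φ, hρs.contDiff_convolution_left _ ρ.contDiff_normed hf.continuous.locallyIntegrable,
    hρs.convolution _ hfs, LipschitzWith.of_dist_le_mul fun x y ↦ ?_, fun x ↦ ?_⟩
  · have hi : Integrable (fun t ↦ ρ.normed volume t * dist x y) :=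
      ρ.integrable_normed.mul_const _
    rw [dist_eq_norm, hφ, convolution_def, convolution_def, ← integral_sub (hex x) (hex y)]
    refine (norm_integral_le_of_norm_le hi (ae_of_all _ fun t ↦ ?_)).trans_eq ?_
    · simp only [ContinuousLinearMap.lsmul_apply, smul_eq_mul, ← mul_sub]
      rw [norm_mul, Real.norm_of_nonneg (ρ.nonneg_normed t)]
      refine mul_le_mul_of_nonneg_left ?_ (ρ.nonneg_normed t)
      have := hf.dist_le_mul (x - t) (y - t)
      rw [dist_sub_right, NNReal.coe_one, one_mul] at this
      rwa [← dist_eq_norm]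
    · rw [integral_mul_const, ρ.integral_normed]; simp
  · rw [← Real.dist_eq]
    refine ContDiffBump.dist_normed_convolution_le hf.continuous.aestronglyMeasurable
      fun y hy ↦ ?_
    have := hf.dist_le_mul y x
    rw [NNReal.coe_one, one_mul] at this
    exact this.trans (Metric.mem_ball.1 hy).le

section

variable {ρ : Measure ℝ} [IsProbabilityMeasure ρ] {m s κ : ℝ}

lemma abs_integral_sub_le_of_lipschitz_of_hasCompactSupport (hs : 0 < s)
    (hρ : HasSteinDiscrepancyLE ρ m s κ) (hρi : Integrable id ρ) {f : ℝ → ℝ}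
    (hf : LipschitzWith 1 f) (hfs : HasCompactSupport f) :
    |∫ x, f x ∂ρ - ∫ x, f x ∂gaussianReal m (s ^ 2).toNNReal| ≤ κ / s := by
  refine le_of_forall_pos_le_add fun ε hε ↦ ?_
  obtain ⟨φ, hφ, hφs, hφl, hφf⟩ := exists_smooth_lipschitz_approx hf hfs (half_pos hε)
  have hφ' : ContDiff ℝ ((⊤ : ℕ∞) : WithTop ℕ∞) (deriv φ) :=
    (contDiff_infty_iff_deriv.1 hφ).2
  have hφ'' : Continuous (deriv (deriv φ)) := (contDiff_infty_iff_deriv.1 hφ').2.continuous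
  obtain ⟨C, hC⟩ := hφ.continuous.bounded_above_of_compact_support hφs
  obtain ⟨C'', hC''⟩ := hφ''.bounded_above_of_compact_support hφs.deriv.deriv
  have key := abs_integral_sub_gaussianReal_le_of_lipschitz hs hρ hρi
    (fun x ↦ ((hφ.differentiable (by simp)) x).hasDerivAt)
    (fun x ↦ ((hφ'.differentiable (by simp)) x).hasDerivAt) hφ'' hC
    (fun x ↦ by simpa using norm_deriv_le_of_lipschitz (x₀ := x) hφl) hC''
  obtain ⟨Cf, hCf⟩ := hf.continuous.bounded_above_of_compact_support hfs
  have hd : ∀ ν : Measure ℝ, IsProbabilityMeasure ν →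
      |∫ x, φ x ∂ν - ∫ x, f x ∂ν| ≤ ε / 2 := by
    intro ν _
    rw [← integral_sub (integrable_of_continuous_of_bound hφ.continuous hC)
      (integrable_of_continuous_of_bound hf.continuous hCf)]
    simpa using norm_integral_le_of_norm_le_const (μ := ν) (f := fun x ↦ φ x - f x)
      (ae_of_all _ hφf)
  have h1 := abs_le.1 (hd ρ inferInstance)
  have h2 := abs_le.1 (hd (gaussianReal m (s ^ 2).toNNReal) inferInstance)
  have h3 := abs_le.1 key
  exact abs_le.2 ⟨by linarith, by linarith⟩

lemma abs_integral_sub_le_of_lipschitzWith_one (hs : 0 < s)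
    (hρ : HasSteinDiscrepancyLE ρ m s κ) (hρi : Integrable id ρ) {f : ℝ → ℝ}
    (hf : LipschitzWith 1 f) :
    |∫ x, f x ∂ρ - ∫ x, f x ∂gaussianReal m (s ^ 2).toNNReal| ≤ κ / s := by
  set N := gaussianReal m (s ^ 2).toNNReal with hN
  have hNi : Integrable (fun x : ℝ ↦ |x|) N := IsGaussian.integrable_id.abs
  have hρi' : Integrable (fun x : ℝ ↦ |x|) ρ := hρi.abs
  set g : ℝ → ℝ := fun x ↦ f x - f 0 with hg
  have hgl : LipschitzWith 1 g := LipschitzWith.of_dist_le_mul fun x y ↦ by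
    simpa [hg, Real.dist_eq] using hf.dist_le_mul x y
  have hgx : ∀ x, |g x| ≤ |x| := fun x ↦ by
    simpa [hg, Real.dist_eq] using hf.dist_le_mul x 0
  -- truncations of `g`
  set q : ℕ → ℝ → ℝ := fun n x ↦ max (n - |x|) 0 with hq
  have hql : ∀ n, LipschitzWith 1 (q n) := fun n ↦ by
    have h1 : LipschitzWith 1 fun x : ℝ ↦ (n : ℝ) - |x| := LipschitzWith.of_dist_le_mul fun x y ↦ by
      rw [Real.dist_eq, Real.dist_eq, NNReal.coe_one, one_mul, sub_sub_sub_cancel_left, abs_sub_comm]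
      exact abs_abs_sub_abs_le_abs_sub x y
    simpa using h1.max (LipschitzWith.const (0 : ℝ))
  -- Clamping g between ±q_n, with q_n a tent of height n, preserves the Lipschitz constant and
  -- gives compact support.
  set t : ℕ → ℝ → ℝ := fun n x ↦ max (min (g x) (q n x)) (-q n x) with ht
  have htl : ∀ n, LipschitzWith 1 (t n) := fun n ↦ by
    simpa using (hgl.min (hql n)).max (hql n).neg
  have hts : ∀ n, HasCompactSupport (t n) := fun n ↦ by
    refine HasCompactSupport.intro (isCompact_Icc (a := -(n : ℝ)) (b := n)) fun x hx ↦ ?_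
    have hx' : (n : ℝ) < |x| := by
      by_contra h
      exact hx (abs_le.1 (not_lt.1 h))
    have hq0 : q n x = 0 := max_eq_right (by linarith)
    simp only [ht, hq0, neg_zero]
    exact max_eq_right (min_le_right _ _)
  have htb : ∀ n x, |t n x| ≤ |x| := fun n x ↦ by
    have hq0 : 0 ≤ q n x := le_max_right _ _
    have h1 := abs_le.1 (hgx x)
    refine abs_le.2 ⟨?_, max_le ((min_le_left _ _).trans h1.2) (by linarith [abs_nonneg x])⟩
    rcases le_total (g x) (q n x) with h | h
    · exact h1.1.trans ((min_eq_left h).ge.trans (le_max_left _ _))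
    · refine le_trans ?_ (le_max_left _ _)
      rw [min_eq_right h]; linarith [abs_nonneg x]
  have htt : ∀ x, Tendsto (fun n ↦ t n x) atTop (𝓝 (g x)) := fun x ↦ by
    refine tendsto_const_nhds.congr' ?_
    -- Once n ≥ 2|x|, the tent at x is at least |x| ≥ |g x| and the clamping is inactive there.
    filter_upwards [eventually_ge_atTop ⌈2 * |x|⌉₊] with n hn
    have hn' : 2 * |x| ≤ n := (Nat.le_ceil _).trans (by exact_mod_cast hn)
    have hqx : |x| ≤ q n x := le_trans (by linarith) (le_max_left _ _)
    have h1 := abs_le.1 (hgx x)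
    simp only [ht]
    rw [min_eq_left (h1.2.trans hqx), max_eq_left (by linarith)]
  have hlim : ∀ ν : Measure ℝ, Integrable (fun x : ℝ ↦ |x|) ν →
      Tendsto (fun n ↦ ∫ x, t n x ∂ν) atTop (𝓝 (∫ x, g x ∂ν)) := fun ν hν ↦
    tendsto_integral_of_dominated_convergence (fun x ↦ |x|)
      (fun n ↦ (htl n).continuous.aestronglyMeasurable) hν (fun n ↦ ae_of_all _ (htb n))
      (ae_of_all _ htt)
  have hgg : |∫ x, g x ∂ρ - ∫ x, g x ∂N| ≤ κ / s :=
    le_of_tendsto ((hlim ρ hρi').sub (hlim N hNi)).abs (Eventually.of_forall fun n ↦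
      abs_integral_sub_le_of_lipschitz_of_hasCompactSupport hs hρ hρi (htl n) (hts n))
  have hfi : ∀ ν : Measure ℝ, IsProbabilityMeasure ν → Integrable (fun x : ℝ ↦ |x|) ν →
      ∫ x, f x ∂ν = ∫ x, g x ∂ν + f 0 := by
    intro ν _ hν
    have hgi : Integrable g ν := hν.mono' hgl.continuous.aestronglyMeasurable (ae_of_all _ hgx)
    have : f = fun x ↦ g x + f 0 := by ext x; simp [hg]
    rw [this, integral_add hgi (integrable_const _), ← this]
    simp
  rw [hfi ρ inferInstance hρi', hfi N inferInstance hNi, add_sub_add_right_eq_sub]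
  exact hgg

lemma abs_measureReal_sub_gaussianReal_le (hs : 0 < s) (hρ : HasSteinDiscrepancyLE ρ m s κ)
    (hρ2 : MemLp id 2 ρ) {A : Set ℝ} (hA : MeasurableSet A) :
    |ρ.real A - (gaussianReal m (s ^ 2).toNNReal).real A| ≤ 2 * κ / s ^ 2 := by
  set N := gaussianReal m (s ^ 2).toNNReal with hN
  refine le_of_forall_pos_le_add fun ε hε ↦ ?_
  set χ : ℝ → ℝ := A.indicator fun _ ↦ 1 with hχ
  have hχi : ∀ ν : Measure ℝ, IsFiniteMeasure ν → Integrable χ ν := fun ν _ ↦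
    (integrable_const 1).indicator hA
  -- Approximating the indicator in L¹ of the sum ρ + N gives one function that works for both laws.
  obtain ⟨g, -, hgχ, hgc, hgi⟩ :=
    (hχi (ρ + N) inferInstance).exists_hasCompactSupport_integral_sub_le hε
  -- Clamping to [0, 1] does not increase the distance to an indicator, and makes the bound for
  -- continuous test functions applicable.
  set φ : ℝ → ℝ := fun x ↦ max 0 (min 1 (g x)) with hφ
  have hφc : Continuous φ := by fun_prop
  have hφ0 : ∀ x, 0 ≤ φ x := fun x ↦ le_max_left _ _
  have hφ1 : ∀ x, φ x ≤ 1 := fun x ↦ max_le zero_le_one (min_le_left _ _)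
  have hφi : ∀ ν : Measure ℝ, IsFiniteMeasure ν → Integrable φ ν := fun ν _ ↦
    integrable_of_continuous_of_bound (C := 1) hφc fun x ↦ by
      rw [Real.norm_of_nonneg (hφ0 x)]; exact hφ1 x
  have hφχ : ∀ x, |χ x - φ x| ≤ ‖χ x - g x‖ := by
    intro x
    have e : χ x = max 0 (min 1 (χ x)) := by
      by_cases hx : x ∈ A <;> simp [hχ, hx]
    calc |χ x - φ x| = |max 0 (min 1 (χ x)) - max 0 (min 1 (g x))| := by rw [← e]
      _ ≤ |min 1 (χ x) - min 1 (g x)| := by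
        rw [max_comm 0, max_comm 0]
        exact abs_max_sub_max_le_abs _ _ 0
      _ ≤ |χ x - g x| := by
        simpa using abs_min_sub_min_le_max 1 (χ x) 1 (g x)
  have hreal : ∀ ν : Measure ℝ, IsFiniteMeasure ν → ν.real A = ∫ x, χ x ∂ν := fun ν _ ↦ by
    rw [hχ, integral_indicator_const _ hA]; simp
  have hdiff : ∀ ν : Measure ℝ, IsFiniteMeasure ν →
      |ν.real A - ∫ x, φ x ∂ν| ≤ ∫ x, |χ x - φ x| ∂ν := fun ν hν ↦ by
    rw [hreal ν hν, ← integral_sub (hχi ν hν) (hφi ν hν)]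
    exact abs_integral_le_integral_abs
  have hsum : ∫ x, |χ x - φ x| ∂ρ + ∫ x, |χ x - φ x| ∂N ≤ ε := by
    have hi : ∀ ν : Measure ℝ, IsFiniteMeasure ν → Integrable (fun x ↦ |χ x - φ x|) ν :=
      fun ν hν ↦ ((hχi ν hν).sub (hφi ν hν)).abs
    rw [← integral_add_measure (hi _ inferInstance) (hi _ inferInstance)]
    exact (integral_mono (hi _ inferInstance)
      ((hχi _ inferInstance).sub hgi).norm hφχ).trans hgχ
  have h1 := abs_le.1 (hdiff ρ inferInstance)
  have h2 := abs_le.1 (hdiff N inferInstance)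
  have h3 := abs_le.1 (abs_integral_sub_gaussianReal_le_of_continuous hs hρ hρ2 hφc hφ0 hφ1)
  exact abs_le.2 ⟨by linarith, by linarith⟩

end

end Malliavin

theorem theorem1p1 {H Ω Ω' : Type*} [NormedAddCommGroup H] [InnerProductSpace ℝ H]
    [CompleteSpace H] [TopologicalSpace.SeparableSpace H]
    [MeasurableSpace Ω] (P : Measure Ω) [IsProbabilityMeasure P]
    [MeasurableSpace Ω'] (P' : Measure Ω') [IsProbabilityMeasure P']
    (X : H → Ω → ℝ) (hX : Malliavin.IsIsonormal X P)
    (F : Ω → ℝ) (DF : Ω → H) (D2F : Ω → Malliavin.HTensor H)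
    (hF : Malliavin.IsMalliavin2 X P 4 F DF D2F)
    (μ σ : ℝ) (hσ : 0 < σ) (hmean : ∫ ω, F ω ∂P = μ) (hvar : variance F P = σ ^ 2)
    (Z : Ω' → ℝ) (hZ : HasLaw Z (gaussianReal μ (σ ^ 2).toNNReal) P') :
    Malliavin.wassersteinDist (P.map F) (P'.map Z) ≤
        ENNReal.ofReal (√10 / (2 * σ))
          * (∫⁻ ω, ‖Malliavin.contractOp (D2F ω)‖ₑ ^ 4 ∂P) ^ (1 / 4 : ℝ)
          * (∫⁻ ω, ‖DF ω‖ₑ ^ 4 ∂P) ^ (1 / 4 : ℝ) ∧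
      (P.map F ≪ volume →
        Malliavin.tvDist (P.map F) (P'.map Z) ≤
          ENNReal.ofReal (√10 / σ ^ 2)
            * (∫⁻ ω, ‖Malliavin.contractOp (D2F ω)‖ₑ ^ 4 ∂P) ^ (1 / 4 : ℝ)
            * (∫⁻ ω, ‖DF ω‖ₑ ^ 4 ∂P) ^ (1 / 4 : ℝ)) := by
  have hstein := hF.hasSteinDiscrepancyLE hX hmean hvar
  have hFm : AEMeasurable F P := hF.memLp.aestronglyMeasurable.aemeasurable
  have : IsProbabilityMeasure (P.map F) := Measure.isProbabilityMeasure_map hFm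
  have hF2 : MemLp F 2 P := hF.memLp.mono_exponent (by norm_num)
  have hρ2 : MemLp id 2 (P.map F) := (memLp_map_measure_iff (by fun_prop) hFm).2 hF2
  have hρi : Integrable id (P.map F) := hρ2.integrable one_le_two
  have hafin : eLpNorm (fun ω ↦ Malliavin.contractOp (D2F ω)) 4 P ≠ ∞ :=
    ((eLpNorm_mono fun ω ↦ Malliavin.norm_contractOp_le (D2F ω)).trans_lt
      hF.memLp_D2.eLpNorm_lt_top).ne
  have hbfin : eLpNorm DF 4 P ≠ ∞ := hF.memLp_D.eLpNorm_ne_top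
  have e4 : ∀ {E : Type _} [NormedAddCommGroup E] (f : Ω → E),
      (∫⁻ ω, ‖f ω‖ₑ ^ 4 ∂P) ^ (1 / 4 : ℝ) = eLpNorm f 4 P := by
    intro E _ f
    rw [eLpNorm_eq_lintegral_rpow_enorm_toReal (by norm_num) (by norm_num)]
    have : (4 : ℝ≥0∞).toReal = ((4 : ℕ) : ℝ) := by norm_num
    simp_rw [this, ENNReal.rpow_natCast]
    norm_num
  rw [hZ.map_eq]
  -- The argument yields the constants 3/2 and 3 in place of √10/2 and √10.
  have h10 : (3 : ℝ) ≤ √10 := Real.le_sqrt_of_sq_le (by norm_num)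
  have eA : (∫⁻ ω, ‖Malliavin.contractOp (D2F ω)‖ₑ ^ 4 ∂P) ^ (1 / 4 : ℝ)
      = ENNReal.ofReal (eLpNorm (fun ω ↦ Malliavin.contractOp (D2F ω)) 4 P).toReal := by
    rw [ENNReal.ofReal_toReal hafin]
    exact e4 fun ω ↦ Malliavin.contractOp (D2F ω)
  have eB : (∫⁻ ω, ‖DF ω‖ₑ ^ 4 ∂P) ^ (1 / 4 : ℝ) = ENNReal.ofReal (eLpNorm DF 4 P).toReal := by
    rw [ENNReal.ofReal_toReal hbfin]
    exact e4 DF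
  rw [eA, eB]
  set a := (eLpNorm (fun ω ↦ Malliavin.contractOp (D2F ω)) 4 P).toReal
  set b := (eLpNorm DF 4 P).toReal
  have ha : 0 ≤ a := ENNReal.toReal_nonneg
  have hb : 0 ≤ b := ENNReal.toReal_nonneg
  rw [← ENNReal.ofReal_mul (by positivity), ← ENNReal.ofReal_mul (by positivity),
    ← ENNReal.ofReal_mul (by positivity), ← ENNReal.ofReal_mul (by positivity)]
  refine ⟨iSup₂_le fun f hf ↦ ENNReal.ofReal_le_ofReal ?_,
    fun _ ↦ iSup₂_le fun A hA ↦ ENNReal.ofReal_le_ofReal ?_⟩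
  · refine (Malliavin.abs_integral_sub_le_of_lipschitzWith_one hσ hstein hρi hf).trans ?_
    rw [show √10 / (2 * σ) * a * b = (√10 / 2 * (a * b)) / σ by field_simp]
    gcongr
  · refine (Malliavin.abs_measureReal_sub_gaussianReal_le hσ hstein hρ2 hA).trans ?_
    rw [show √10 / σ ^ 2 * a * b = (√10 * (a * b)) / σ ^ 2 by field_simp]
    rw [show 2 * (3 / 2 * (a * b)) = 3 * (a * b) by ring]
    gcongr
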